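/- For every $C_\Omega>0$ there is a constant $C>0$, depending only on $C_\Omega$, such that the following holds. Let $T>0$, $C_{\partial\Omega}>0$, and for each $t\in[0,T]$ let $\Omega(t)\subset\mathbb R$ be a bounded open set (not necessarily connected) with $|\Omega(t)|\le C_\Omega$ and $|\partial\Omega(t)|\le C_{\partial\Omega}$, where $|\Omega(t)|$ is the Lebesgue measure and $|\partial\Omega(t)|$ the number of points. Put $$Q=\{(x,t): 0<t<T,\ x\in\Omega(t)\},\qquad \Sigma_s=\{(x,t): 0<t<T,\ x\in\partial\Omega(t)\},$$ and assume that $Q$ is open in $\mathbb R^2$. Assume moreover that there are finitely many bounded sets $O_1,\dots,O_N\subset\mathbb R^2$, each open or closed, whose union contains an open set containing $\Sigma_s$, and for each $i$ numbers $0\le\alpha_i$ and $\beta_i$ with $O_i\subset\{\alpha_i\le t\le\beta_i\}$ and a $C^2$-diffeomorphism $h_i$ from $\overline{O_i}$ onto $\overline{B_i}$, $B_i=\{(\xi,\tau): -1<\xi<1,\ \alpha_i<\tau<\beta_i\}$, of the form $h_i(x,t)=(\xi_i(x,t),t)$, which maps $\overline{Q\cap O_i}$ bijectively onto $\overline{B_i}\cap\{\xi\ge0\}$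 and $\overline{\Sigma_s\cap O_i}$ bijectively onto $\overline{B_i}\cap\{\xi=0\}$. Let $H^{1,0}(Q)=\{u\in L^2(Q):\partial_x u\in L^2(Q)\}$ (weak derivative), with $\|u\|_{H^{1,0}(Q)}^2=2\|u\|_Q^2+\|\partial_x u\|_Q^2$, where $\|\cdot\|_Q$ is the norm of $L^2(Q)$, and let $\|\cdot\|_{\Sigma_s}$ be the norm of $L^2(\Sigma_s)$ with respect to arc length (the one-dimensional Hausdorff measure of the Euclidean plane). Then there is exactly one continuous linear operator $\gamma_s:H^{1,0}(Q)\to L^2(\Sigma_s)$ with $\gamma_s\varphi=\varphi|_{\Sigma_s}$ for all $\varphi\in C^1(\overline Q)$, and $$\|u\|_Q\le C\left(\|\partial_x u\|_Q+\|\gamma_s u\|_{\Sigma_s}\right)\qquad\text{for all }u\in H^{1,0}(Q).$$ -/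

import Mathlib

open MeasureTheory Set
open scoped ContDiff

noncomputable section

/-! Points of space-time are pairs `z = (x, t) : ℝ × ℝ`, with `x` the space and `t` the time variable. -/

/-- The space-time domain `Q = {(x, t) : 0 < t < T, x ∈ Ω(t)}`. -/
def spaceTime (Ω : ℝ → Set ℝ) (T : ℝ) : Set (ℝ × ℝ) :=
  {z | z.2 ∈ Ioo 0 T ∧ z.1 ∈ Ω z.2}

/-- The lateral boundary `Σ_s = {(x, t) : 0 < t < T, x ∈ ∂Ω(t)}`. -/
def lateral (Ω : ℝ → Set ℝ) (T : ℝ) : Set (ℝ × ℝ) :=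
  {z | z.2 ∈ Ioo 0 T ∧ z.1 ∈ frontier (Ω z.2)}

/-- The arc-length measure on a set `S` of the plane: the one-dimensional Hausdorff measure of the
Euclidean plane (the metric of `ℝ × ℝ` itself is the maximum metric), restricted to `S`. -/
def arcLength (S : Set (ℝ × ℝ)) : Measure (ℝ × ℝ) :=
  ((Measure.hausdorffMeasure 1 : Measure (WithLp 2 (ℝ × ℝ))).map WithLp.ofLp).restrict S

/-- The uniform bounds `|Ω(t)| ≤ C_Ω` (length) and `|∂Ω(t)| ≤ C_∂Ω` (number of points). -/
def UniformBounds (Ω : ℝ → Set ℝ) (T CΩ CdΩ : ℝ) : Prop :=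
  ∀ t ∈ Icc 0 T, volume (Ω t) ≤ ENNReal.ofReal CΩ ∧
    Measure.count (frontier (Ω t)) ≤ ENNReal.ofReal CdΩ

/-- The box `B(α, β) = {(ξ, τ) : -1 < ξ < 1, α < τ < β}`. -/
def box (α β : ℝ) : Set (ℝ × ℝ) := Ioo (-1) 1 ×ˢ Ioo α β

/-- `h` is a time-preserving `C²`-diffeomorphism of `closure O` onto `closure (box α β)` that
flattens the lateral boundary `S` of `Q` to `{ξ = 0}` and sends `Q` to the side `{ξ ≥ 0}`. -/
structure IsLateralChart (Q S O : Set (ℝ × ℝ)) (α β : ℝ) (h : ℝ × ℝ → ℝ × ℝ) : Prop where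
  isOpen_or_isClosed : IsOpen O ∨ IsClosed O
  isBounded : Bornology.IsBounded O
  nonneg : 0 ≤ α
  strip : ∀ z ∈ O, z.2 ∈ Icc α β
  contDiffOn : ContDiffOn ℝ 2 h (closure O)
  bijOn : BijOn h (closure O) (closure (box α β))
  contDiffOn_inv : ContDiffOn ℝ 2 (Function.invFunOn h (closure O)) (closure (box α β))
  time : ∀ z ∈ closure O, (h z).2 = z.2
  bijOn_domain : BijOn h (closure (Q ∩ O)) (closure (box α β) ∩ {w | 0 ≤ w.1})
  bijOn_lateral : BijOn h (closure (S ∩ O)) (closure (box α β) ∩ {w | w.1 = 0})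

/-- Finitely many charts whose domains cover a neighbourhood of the lateral boundary. -/
def HasLateralCharts (Q S : Set (ℝ × ℝ)) : Prop :=
  ∃ (N : ℕ) (O : Fin N → Set (ℝ × ℝ)) (α β : Fin N → ℝ) (h : Fin N → ℝ × ℝ → ℝ × ℝ),
    (∃ V : Set (ℝ × ℝ), IsOpen V ∧ S ⊆ V ∧ V ⊆ ⋃ i, O i) ∧
    ∀ i, IsLateralChart Q S (O i) (α i) (β i) (h i)

/-- `L²(Q)` for Lebesgue measure on the plane. -/
abbrev L2 (Q : Set (ℝ × ℝ)) : Type := Lp ℝ 2 ((volume : Measure (ℝ × ℝ)).restrict Q)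

/-- `L²(S)` for the arc-length measure. -/
abbrev L2Lateral (S : Set (ℝ × ℝ)) : Type := Lp ℝ 2 (arcLength S)

/-- `g` is the weak space derivative `∂ₓ u` in `Q`. -/
def IsWeakDx (Q : Set (ℝ × ℝ)) (u g : L2 Q) : Prop :=
  ∀ φ : ℝ × ℝ → ℝ, ContDiff ℝ ∞ φ → HasCompactSupport φ → tsupport φ ⊆ Q →
    ∫ z in Q, u z * fderiv ℝ φ z (1, 0) = -∫ z in Q, g z * φ z

lemma integrable_mul_test {Q : Set (ℝ × ℝ)} (u : L2 Q) {ψ : ℝ × ℝ → ℝ}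
    (hψ : Continuous ψ) (hc : HasCompactSupport ψ) :
    Integrable (fun z => u z * ψ z) ((volume : Measure (ℝ × ℝ)).restrict Q) :=
  (Lp.memLp u).integrable_mul (q := 2)
    ((hψ.memLp_of_hasCompactSupport (p := 2) hc).restrict Q)

lemma continuous_dx_test {φ : ℝ × ℝ → ℝ} (hφ : ContDiff ℝ ∞ φ) :
    Continuous fun z => fderiv ℝ φ z (1, 0) :=
  (hφ.continuous_fderiv (by simp)).clm_apply continuous_const

lemma IsWeakDx.zero (Q : Set (ℝ × ℝ)) : IsWeakDx Q 0 0 := by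
  intro φ _ _ _
  have h0 : ((0 : L2 Q) : ℝ × ℝ → ℝ) =ᵐ[volume.restrict Q] 0 := Lp.coeFn_zero _ _ _
  rw [integral_congr_ae (g := 0) (h0.mono fun z hz => by rw [hz]; simp),
    integral_congr_ae (f := fun z => ((0 : L2 Q) z) * φ z) (g := 0)
      (h0.mono fun z hz => by beta_reduce; rw [hz]; simp)]
  simp

lemma IsWeakDx.add {Q : Set (ℝ × ℝ)} {u v g k : L2 Q} (hu : IsWeakDx Q u g)
    (hv : IsWeakDx Q v k) : IsWeakDx Q (u + v) (g + k) := by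
  intro φ hφ hc hs
  have hc' : HasCompactSupport fun z => fderiv ℝ φ z (1, 0) := hc.fderiv_apply ℝ _
  have hd := continuous_dx_test hφ
  rw [integral_congr_ae (g := fun z => u z * fderiv ℝ φ z (1, 0) + v z * fderiv ℝ φ z (1, 0))
      ((Lp.coeFn_add u v).mono fun z hz => by beta_reduce; rw [hz, Pi.add_apply, add_mul]),
    integral_congr_ae (f := fun z => (g + k : L2 Q) z * φ z)
      (g := fun z => g z * φ z + k z * φ z)
      ((Lp.coeFn_add g k).mono fun z hz => by beta_reduce; rw [hz, Pi.add_apply, add_mul]),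
    integral_add (integrable_mul_test u hd hc') (integrable_mul_test v hd hc'),
    integral_add (integrable_mul_test g hφ.continuous hc)
      (integrable_mul_test k hφ.continuous hc), hu φ hφ hc hs, hv φ hφ hc hs]
  ring

lemma IsWeakDx.smul {Q : Set (ℝ × ℝ)} {u g : L2 Q} (c : ℝ) (hu : IsWeakDx Q u g) :
    IsWeakDx Q (c • u) (c • g) := by
  intro φ hφ hc hs
  rw [integral_congr_ae (g := fun z => c * (u z * fderiv ℝ φ z (1, 0)))
      ((Lp.coeFn_smul c u).mono fun z hz => by
        beta_reduce; rw [hz, Pi.smul_apply, smul_eq_mul, mul_assoc]),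
    integral_congr_ae (f := fun z => (c • g : L2 Q) z * φ z) (g := fun z => c * (g z * φ z))
      ((Lp.coeFn_smul c g).mono fun z hz => by
        beta_reduce; rw [hz, Pi.smul_apply, smul_eq_mul, mul_assoc]),
    integral_const_mul, integral_const_mul, hu φ hφ hc hs]
  ring

/-- The anisotropic Sobolev space `H^{1,0}(Q) = {u ∈ L²(Q) : ∂ₓ u ∈ L²(Q)}`. -/
def H10 (Q : Set (ℝ × ℝ)) : Submodule ℝ (L2 Q) where
  carrier := {u | ∃ g, IsWeakDx Q u g}
  zero_mem' := ⟨0, IsWeakDx.zero Q⟩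
  add_mem' := fun ⟨g, hg⟩ ⟨k, hk⟩ => ⟨g + k, hg.add hk⟩
  smul_mem' := fun c _ ⟨g, hg⟩ => ⟨c • g, hg.smul c⟩

/-- The weak space derivative `∂ₓ u ∈ L²(Q)` of `u ∈ H^{1,0}(Q)` (unique when `Q` is open). -/
def dx {Q : Set (ℝ × ℝ)} (u : H10 Q) : L2 Q := Classical.choose u.2

/-- The norm of `H^{1,0}(Q)`; `‖u‖²` is counted once as a space derivative and once as a time
derivative of order zero. -/
def h10Norm {Q : Set (ℝ × ℝ)} (u : H10 Q) : ℝ :=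
  √((‖(u : L2 Q)‖ ^ 2 + ‖dx u‖ ^ 2) + ‖(u : L2 Q)‖ ^ 2)

/-- `γ : H^{1,0}(Q) → L²(S)` is a trace operator: linear, continuous, and equal to the pointwise
restriction `φ ↦ φ|_S` on `C¹(closure Q)`. -/
def IsTraceOperator (Q S : Set (ℝ × ℝ)) (γ : H10 Q →ₗ[ℝ] L2Lateral S) : Prop :=
  (∃ K : ℝ, ∀ u, ‖γ u‖ ≤ K * h10Norm u) ∧
  ∀ φ : ℝ × ℝ → ℝ, ContDiffOn ℝ 1 φ (closure Q) →
    ∀ u : H10 Q, ((u : L2 Q) : ℝ × ℝ → ℝ) =ᵐ[volume.restrict Q] φ →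
      (γ u : ℝ × ℝ → ℝ) =ᵐ[arcLength S] φ

end

/-! Everything happens on the time slices. The charts have the form `(ξ(x,t), t)`, so off the
finitely many times `α i`, `β i` each slice is a bounded open set with finite boundary, and each
boundary point has an interval of a fixed length `δ` inside the slice on one side and one outside it
on the other. The lateral boundary lies on finitely many Lipschitz graphs `x = c i t`
(`exists_hasLateralCurves`). On such graphs arc length is at most `K + 1` times `dt`, and projecting
to `t` does not increase it.

For functions that are `C¹` up to the boundary, both estimates come from the fundamental theorem of
calculus on intervals. Averaging over an interval of length `δ` at a boundary point bounds the
boundary value by the `H¹` norm on the slice. Integrating from the left end of each component, whose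
length is at most `|Ω(t)| ≤ C_Ω`, bounds the `L²` norm by the boundary values and the derivative.
Integration in `t` gives the trace bound, whose constant depends on `δ`, `K` and `N`, and the
Poincaré inequality, whose constant depends on `C_Ω` alone.

The remaining point is density of `C¹(closure Q)` in `H^{1,0}(Q)`
(`graphMap_mem_topologicalClosure`), proved by duality. If `(f, h)` is orthogonal to all `(φ, ∂ₓφ)`
with `φ` smooth on the plane, then, after extension by zero, `h(x,t) = -∫_x^∞ f(y,t) dy`. As `h`
vanishes outside `Q`, this primitive vanishes on the outer intervals, hence by continuity at every
boundary point. On almost every slice `u` is a primitive of `∂ₓu` on each component, so integration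
by parts without boundary terms shows that `(f, h)` is orthogonal to `(u, ∂ₓu)`. The trace is then
the extension by continuity, it is unique, and the Poincaré inequality passes to the limit. -/

open Filter Topology
open scoped ENNReal NNReal

/-! ### Boundary curves from lateral charts -/

/-- The section of a space-time set at time `t`. -/
def timeSlice (Q : Set (ℝ × ℝ)) (t : ℝ) : Set ℝ := {x | (x, t) ∈ Q}

/-- A bounded open subset of the line with finitely many boundary points, each of which has an
interval of length `δ` in the set on one side and an interval of length `δ` outside the set on the
other side. -/
structure HasSeparatedBoundary (δ : ℝ) (A : Set ℝ) : Prop where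
  isOpen : IsOpen A
  isBounded : Bornology.IsBounded A
  finite_frontier : (frontier A).Finite
  exists_inner : ∀ x ∈ frontier A, ∃ d, δ ≤ |d - x| ∧ uIoo x d ⊆ A
  exists_outer : ∀ x ∈ frontier A, ∃ e, δ ≤ |e - x| ∧ Disjoint (uIoo x e) A

lemma closure_box {α β : ℝ} (h : α < β) : closure (box α β) = Icc (-1) 1 ×ˢ Icc α β := by
  rw [box, closure_prod_eq, closure_Ioo (by norm_num), closure_Ioo h.ne]

/-- The boundary curve `c` of a lateral chart together with the two outer curves `a` (on the side
outside of `Q`) and `b` (on the side of `Q`) of its domain. -/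
structure IsLateralStrip (Q S O : Set (ℝ × ℝ)) (α β δ : ℝ) (K : ℝ≥0) (a c b : ℝ → ℝ) : Prop where
  lipschitz : LipschitzWith K c
  outer_dist : ∀ t ∈ Ioo α β, δ ≤ |a t - c t|
  inner_dist : ∀ t ∈ Ioo α β, δ ≤ |b t - c t|
  between : ∀ t ∈ Ioo α β, c t ∈ uIoo (a t) (b t)
  isOpen_outer : IsOpen {z : ℝ × ℝ | z.2 ∈ Ioo α β ∧ z.1 ∈ uIoo (a z.2) (c z.2)}
  outer_notMem : ∀ t ∈ Ioo α β, ∀ x ∈ uIoo (a t) (c t), (x, t) ∉ Q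
  inner_mem : ∀ t ∈ Ioo α β, ∀ x ∈ uIoo (c t) (b t), (x, t) ∈ closure Q
  mem_graph : ∀ z ∈ S ∩ O, z.1 = c z.2

/-- If `β ≤ α` the box is empty, and a bijection onto its closure forces the chart domain to be
empty. Degenerate charts therefore cover nothing. -/
lemma IsLateralChart.lt_of_nonempty {Q S O : Set (ℝ × ℝ)} {α β : ℝ} {h : ℝ × ℝ → ℝ × ℝ}
    (H : IsLateralChart Q S O α β h) {z : ℝ × ℝ} (hz : z ∈ O) : α < β := by
  have h1 := H.bijOn.mapsTo (subset_closure hz)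
  by_contra hlt
  rw [box, Ioo_eq_empty hlt] at h1
  simp at h1

/-- The inverse chart `k` preserves time, so `t ↦ (k (ξ, t)).1` for `ξ = -1, 0, 1` are the curves
`a`, `c`, `b`. Injectivity in `ξ` keeps them apart, and compactness of the time interval makes the
distance uniform. -/
lemma IsLateralChart.exists_isLateralStrip {Q S O : Set (ℝ × ℝ)} {α β : ℝ}
    {h : ℝ × ℝ → ℝ × ℝ} (hQ : IsOpen Q) (H : IsLateralChart Q S O α β h) :
    ∃ (δ : ℝ) (K : ℝ≥0) (a c b : ℝ → ℝ), 0 < δ ∧ IsLateralStrip Q S O α β δ K a c b := by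
  rcases le_or_gt β α with hle | hlt
  · refine ⟨1, 0, 0, 0, 0, one_pos, LipschitzWith.const 0, ?_, ?_, ?_, ?_, ?_, ?_, ?_⟩
    · simp [Ioo_eq_empty_of_le hle]
    · simp [Ioo_eq_empty_of_le hle]
    · simp [Ioo_eq_empty_of_le hle]
    · simp [Ioo_eq_empty_of_le hle]
    · simp [Ioo_eq_empty_of_le hle]
    · simp [Ioo_eq_empty_of_le hle]
    · intro z hz
      exact absurd (H.lt_of_nonempty hz.2) hle.not_gt
  set k := Function.invFunOn h (closure O) with hk
  have hbox := closure_box hlt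
  have hinv : InvOn k h (closure O) (closure (box α β)) := H.bijOn.invOn_invFunOn
  have hkmem : ∀ w ∈ closure (box α β), k w ∈ closure O := H.bijOn.surjOn.mapsTo_invFunOn
  have hk2 : ∀ w ∈ closure (box α β), (k w).2 = w.2 := fun w hw => by
    rw [← H.time _ (hkmem w hw), hinv.2 hw]
  have hmem : ∀ {ξ t : ℝ}, ξ ∈ Icc (-1 : ℝ) 1 → t ∈ Icc α β → (ξ, t) ∈ closure (box α β) :=
    fun h1 h2 => by rw [hbox]; exact ⟨h1, h2⟩
  have hkeq : ∀ {ξ t : ℝ}, ξ ∈ Icc (-1 : ℝ) 1 → t ∈ Icc α β → k (ξ, t) = ((k (ξ, t)).1, t) :=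
    fun h1 h2 => Prod.ext rfl (hk2 _ (hmem h1 h2))
  -- the curves `ξ = const` are Lipschitz
  have hlip : ∀ ξ ∈ Icc (-1 : ℝ) 1, ∃ K : ℝ≥0, ∃ c : ℝ → ℝ, LipschitzWith K c ∧
      ∀ t ∈ Icc α β, (k (ξ, t)).1 = c t := by
    intro ξ hξ
    have hc : ContDiffOn ℝ 2 (fun t : ℝ => (k (ξ, t)).1) (Icc α β) :=
      contDiff_fst.comp_contDiffOn (H.contDiffOn_inv.comp
        (contDiff_prodMk_right ξ).contDiffOn fun t ht => hmem hξ ht)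
    obtain ⟨K, hK⟩ := hc.exists_lipschitzOnWith (by norm_num) (convex_Icc α β) isCompact_Icc
    obtain ⟨c, hc1, hc2⟩ := hK.extend_real
    exact ⟨K, c, hc1, hc2⟩
  have m0 : (0 : ℝ) ∈ Icc (-1 : ℝ) 1 := by norm_num
  have m1 : (1 : ℝ) ∈ Icc (-1 : ℝ) 1 := by norm_num
  have m2 : (-1 : ℝ) ∈ Icc (-1 : ℝ) 1 := by norm_num
  obtain ⟨Ka, a, ha, ha'⟩ := hlip (-1) m2
  obtain ⟨Kc, c, hc, hc'⟩ := hlip 0 m0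
  obtain ⟨Kb, b, hb, hb'⟩ := hlip 1 m1
  have hinj : ∀ t ∈ Icc α β, InjOn (fun ξ : ℝ => (k (ξ, t)).1) (Icc (-1) 1) := by
    intro t ht ξ hξ η hη he
    have h1 : k (ξ, t) = k (η, t) := by rw [hkeq hξ ht, hkeq hη ht]; exact Prod.ext he rfl
    have h2 := hinv.2.injOn (hmem hξ ht) (hmem hη ht) h1
    exact congrArg Prod.fst h2
  have hcont : ∀ t ∈ Icc α β, ContinuousOn (fun ξ : ℝ => (k (ξ, t)).1) (Icc (-1) 1) :=
    fun t ht => continuous_fst.comp_continuousOn (H.contDiffOn_inv.continuousOn.comp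
      (by fun_prop) fun ξ hξ => hmem hξ ht)
  have hpos : ∀ f : ℝ → ℝ, Continuous f → (∀ t ∈ Icc α β, f t ≠ 0) →
      ∃ δ > 0, ∀ t ∈ Icc α β, δ ≤ |f t| := by
    intro f hf hne
    obtain ⟨t₀, ht₀, hmin⟩ := isCompact_Icc.exists_isMinOn (nonempty_Icc.2 hlt.le)
      (f := fun t => |f t|) (by fun_prop)
    exact ⟨|f t₀|, abs_pos.2 (hne t₀ ht₀), fun t ht => hmin ht⟩
  obtain ⟨δ₁, hδ₁, hd₁⟩ := hpos (fun t => a t - c t) (ha.continuous.sub hc.continuous) (by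
    intro t ht h0
    have h1 := hinj t ht m2 m0 (by beta_reduce; rw [ha' t ht, hc' t ht]; linarith)
    norm_num at h1)
  obtain ⟨δ₂, hδ₂, hd₂⟩ := hpos (fun t => b t - c t) (hb.continuous.sub hc.continuous) (by
    intro t ht h0
    have h1 := hinj t ht m1 m0 (by beta_reduce; rw [hb' t ht, hc' t ht]; linarith)
    norm_num at h1)
  -- points between two of the curves
  have hbetw : ∀ t ∈ Icc α β, ∀ ξ ∈ Icc (-1 : ℝ) 1, ∀ η ∈ Icc (-1 : ℝ) 1, ξ ≤ η →
      ∀ x ∈ uIoo (k (ξ, t)).1 (k (η, t)).1, ∃ ζ ∈ Ioo ξ η, k (ζ, t) = (x, t) := by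
    intro t ht ξ hξ η hη hle x hx
    have hsub : uIcc ξ η ⊆ Icc (-1) 1 := uIcc_subset_Icc hξ hη
    obtain ⟨ζ, hζ, hζx⟩ := intermediate_value_uIcc ((hcont t ht).mono hsub)
      (uIoo_subset_uIcc_self hx)
    rw [uIcc_of_le hle] at hζ hsub
    have h1 : ζ ≠ ξ := by rintro rfl; beta_reduce at hζx; rw [hζx] at hx; simp at hx
    have h2 : ζ ≠ η := by rintro rfl; beta_reduce at hζx; rw [hζx] at hx; simp at hx
    refine ⟨ζ, ⟨lt_of_le_of_ne hζ.1 h1.symm, lt_of_le_of_ne hζ.2 h2⟩, ?_⟩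
    rw [hkeq (hsub hζ) ht]
    exact Prod.ext hζx rfl
  have hopen : IsOpen {z : ℝ × ℝ | z.2 ∈ Ioo α β ∧ z.1 ∈ uIoo (a z.2) (c z.2)} := by
    have := ha.continuous
    have := hc.continuous
    refine (isOpen_Ioo.preimage continuous_snd).inter
      ((isOpen_lt (f := fun z : ℝ × ℝ => a z.2 ⊓ c z.2) ?_ continuous_fst).inter
      (isOpen_lt (g := fun z : ℝ × ℝ => a z.2 ⊔ c z.2) continuous_fst ?_))
    · fun_prop
    · fun_prop
  have hU : ∀ t ∈ Ioo α β, ∀ x ∈ uIoo (a t) (c t), (x, t) ∈ closure O ∧ (h (x, t)).1 < 0 := by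
    intro t ht x hx
    have ht' := Ioo_subset_Icc_self ht
    rw [← ha' t ht', ← hc' t ht'] at hx
    obtain ⟨ζ, hζ, he⟩ := hbetw t ht' _ m2 _ m0 (by norm_num) x hx
    have hm := hmem (ξ := ζ) ⟨hζ.1.le, by linarith [hζ.2]⟩ ht'
    rw [← he]
    exact ⟨hkmem _ hm, by rw [hinv.2 hm]; exact hζ.2⟩
  refine ⟨min δ₁ δ₂, Kc, a, c, b, lt_min hδ₁ hδ₂, hc, ?_, ?_, ?_, hopen, ?_, ?_, ?_⟩
  · exact fun t ht => (min_le_left _ _).trans (hd₁ t (Ioo_subset_Icc_self ht))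
  · exact fun t ht => (min_le_right _ _).trans (hd₂ t (Ioo_subset_Icc_self ht))
  · intro t ht
    have ht' := Ioo_subset_Icc_self ht
    rw [← ha' t ht', ← hc' t ht', ← hb' t ht']
    -- A chart may preserve or reverse the orientation in `x`, which is why unordered intervals are
    -- used throughout.
    rcases (hcont t ht').strictMonoOn_of_injOn_Icc' (by norm_num) (hinj t ht') with hm | hm
    · exact mem_uIoo_of_lt (hm m2 m0 (by norm_num)) (hm m0 m1 (by norm_num))
    · exact mem_uIoo_of_gt (hm m0 m1 (by norm_num)) (hm m2 m0 (by norm_num))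
  · intro t ht x hx hxQ
    have hzO := (hU t ht x hx).1
    -- The point is only known to lie in `closure O`. Since the outer region and `Q` are open, it
    -- can be moved into `O`, where the chart sends `Q` to `ξ ≥ 0` but the outer region to `ξ < 0`.
    obtain ⟨z, hz1, hz2⟩ := mem_closure_iff.1 hzO _ (hopen.inter hQ) ⟨⟨ht, hx⟩, hxQ⟩
    have h3 := (H.bijOn_domain.mapsTo (subset_closure ⟨hz1.2, hz2⟩)).2
    exact absurd (hU z.2 hz1.1.1 z.1 hz1.1.2).2 (not_lt.2 h3)
  · intro t ht x hx
    have ht' := Ioo_subset_Icc_self ht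
    rw [← hb' t ht', ← hc' t ht'] at hx
    obtain ⟨ζ, hζ, he⟩ := hbetw t ht' _ m0 _ m1 (by norm_num) x hx
    have hm := hmem (ξ := ζ) ⟨by linarith [hζ.1], hζ.2.le⟩ ht'
    obtain ⟨w, hw, hw'⟩ := H.bijOn_domain.surjOn (show (ζ, t) ∈ _ from ⟨hm, hζ.1.le⟩)
    have hwO : w ∈ closure O := closure_mono inter_subset_right hw
    rw [← he, ← hw', hinv.1 hwO]
    exact closure_mono inter_subset_left hw
  · rintro z ⟨hzS, hzO⟩
    have h1 := (H.bijOn_lateral.mapsTo (subset_closure ⟨hzS, hzO⟩)).2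
    have hz' := subset_closure hzO
    have h2 : h z = (0, z.2) := Prod.ext h1 (H.time z hz')
    rw [← hc' z.2 (H.strip z hzO), ← h2, hinv.1 hz']

/-! ### Topology of the time slices and of the lateral boundary -/

lemma timeSlice_spaceTime {Ω : ℝ → Set ℝ} {T t : ℝ} (ht : t ∈ Ioo 0 T) :
    timeSlice (spaceTime Ω T) t = Ω t := by
  ext x
  simp only [timeSlice, spaceTime, mem_ofPred_eq]
  exact and_iff_right ht

lemma timeSlice_spaceTime_of_notMem {Ω : ℝ → Set ℝ} {T t : ℝ} (ht : t ∉ Ioo 0 T) :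
    timeSlice (spaceTime Ω T) t = ∅ := by
  ext x
  simp only [timeSlice, spaceTime, mem_ofPred_eq, mem_empty_iff_false, iff_false]
  exact fun h => ht h.1

lemma mem_lateral_iff {Ω : ℝ → Set ℝ} {T : ℝ} {z : ℝ × ℝ} :
    z ∈ lateral Ω T ↔ z.1 ∈ frontier (timeSlice (spaceTime Ω T) z.2) := by
  by_cases ht : z.2 ∈ Ioo 0 T
  · rw [timeSlice_spaceTime ht]
    simp only [lateral, mem_ofPred_eq]
    exact and_iff_right ht
  · rw [timeSlice_spaceTime_of_notMem ht]
    simp only [lateral, mem_ofPred_eq, frontier_empty, mem_empty_iff_false, iff_false]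
    exact fun h => ht h.1

lemma isOpen_timeSlice {Q : Set (ℝ × ℝ)} (hQ : IsOpen Q) (t : ℝ) : IsOpen (timeSlice Q t) :=
  hQ.preimage (by fun_prop : Continuous fun x : ℝ => (x, t))

lemma mem_closure_of_mem_closure_timeSlice {Q : Set (ℝ × ℝ)} {x t : ℝ}
    (h : x ∈ closure (timeSlice Q t)) : (x, t) ∈ closure Q :=
  map_mem_closure (f := fun x : ℝ => (x, t)) (by fun_prop) h fun _ hy => hy

lemma lateral_subset_closure {Ω : ℝ → Set ℝ} {T : ℝ} :
    lateral Ω T ⊆ closure (spaceTime Ω T) := fun _ hz =>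
  mem_closure_of_mem_closure_timeSlice (frontier_subset_closure (mem_lateral_iff.1 hz))

/-- The slices are open, so membership in the closure of a slice can be tested with rational points.
This writes the slicewise closure as a countable combination of open sets, from which `Q` is
removed. -/
lemma measurableSet_lateral {Ω : ℝ → Set ℝ} {T : ℝ} (hQ : IsOpen (spaceTime Ω T)) :
    MeasurableSet (lateral Ω T) := by
  set Q := spaceTime Ω T
  have heq : lateral Ω T = (⋂ n : ℕ, ⋃ q : ℚ, {z : ℝ × ℝ | |(q : ℝ) - z.1| < 1 / ((n : ℝ) + 1)} ∩
      (fun z : ℝ × ℝ => ((q : ℝ), z.2)) ⁻¹' Q) \ Q := by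
    ext z
    rw [mem_lateral_iff, (isOpen_timeSlice hQ z.2).frontier_eq, Set.mem_sdiff, Set.mem_sdiff]
    refine and_congr ?_ Iff.rfl
    simp only [mem_iInter, mem_iUnion, mem_inter_iff, mem_ofPred_eq, mem_preimage]
    rw [Metric.mem_closure_iff]
    constructor
    · intro h n
      obtain ⟨y, hy, hd⟩ := h (1 / ((n : ℝ) + 1)) Nat.one_div_pos_of_nat
      have ho : IsOpen (timeSlice Q z.2 ∩ {y | |y - z.1| < 1 / ((n : ℝ) + 1)}) :=
        (isOpen_timeSlice hQ z.2).inter (isOpen_lt (by fun_prop) continuous_const)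
      rw [dist_comm, Real.dist_eq] at hd
      obtain ⟨q, hq⟩ := Rat.denseRange_cast.exists_mem_open ho ⟨y, hy, hd⟩
      exact ⟨q, hq.2, hq.1⟩
    · intro h ε hε
      obtain ⟨n, hn⟩ := exists_nat_one_div_lt hε
      obtain ⟨q, hq, hqQ⟩ := h n
      exact ⟨q, hqQ, by rw [dist_comm, Real.dist_eq]; exact hq.trans hn⟩
  rw [heq]
  refine MeasurableSet.diff (MeasurableSet.iInter fun n => MeasurableSet.iUnion fun q => ?_)
    hQ.measurableSet
  exact ((isOpen_lt (by fun_prop) continuous_const).inter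
    (hQ.preimage (by fun_prop))).measurableSet

lemma IsPreconnected.inter_frontier_nonempty {X : Type*} [TopologicalSpace X] {s u : Set X}
    (hs : IsPreconnected s) (h1 : (s ∩ u).Nonempty) (h2 : (s ∩ uᶜ).Nonempty) :
    (s ∩ frontier u).Nonempty := by
  by_contra hne
  rw [not_nonempty_iff_eq_empty, ← disjoint_iff_inter_eq_empty, disjoint_left] at hne
  have hint : ∀ x ∈ s, x ∈ closure u → x ∈ interior u := fun x hx hxu => by
    by_contra hxi
    exact hne hx ⟨hxu, hxi⟩
  obtain ⟨x, hx, hxu⟩ := h1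
  obtain ⟨y, hy, hyu⟩ := h2
  obtain ⟨w, -, hw1, hw2⟩ := hs (interior u) (closure u)ᶜ isOpen_interior
    isClosed_closure.isOpen_compl
    (fun w hw => or_iff_not_imp_right.2 fun h => hint w hw (not_not.1 h))
    ⟨x, hx, hint x hx (subset_closure hxu)⟩
    ⟨y, hy, fun h => hyu (interior_subset (hint y hy h))⟩
  exact hw2 (subset_closure (interior_subset hw1))

lemma exists_mem_frontier_ge {A : Set ℝ} (hA : BddAbove A) {x : ℝ} (hx : x ∈ A) :
    ∃ y ∈ frontier A, x ≤ y := by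
  obtain ⟨M, hM⟩ := hA
  obtain ⟨y, hy⟩ := (isPreconnected_Ici (a := x)).inter_frontier_nonempty (u := A)
    ⟨x, self_mem_Ici, hx⟩ ⟨M + 1, by
      have := hM hx
      exact mem_Ici.2 (by linarith), fun h => by have := hM h; linarith⟩
  exact ⟨y, hy.2, hy.1⟩

lemma exists_mem_frontier_le {A : Set ℝ} (hA : BddBelow A) {x : ℝ} (hx : x ∈ A) :
    ∃ y ∈ frontier A, y ≤ x := by
  obtain ⟨M, hM⟩ := hA
  obtain ⟨y, hy⟩ := (isPreconnected_Iic (a := x)).inter_frontier_nonempty (u := A)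
    ⟨x, self_mem_Iic, hx⟩ ⟨M - 1, by
      have := hM hx
      exact mem_Iic.2 (by linarith), fun h => by have := hM h; linarith⟩
  exact ⟨y, hy.2, hy.1⟩

/-- Every point of a slice lies between two boundary points of that slice. -/
lemma isBounded_spaceTime {Ω : ℝ → Set ℝ} {T : ℝ}
    (hΩ : ∀ t ∈ Icc 0 T, IsOpen (Ω t) ∧ Bornology.IsBounded (Ω t))
    (hS : Bornology.IsBounded (lateral Ω T)) : Bornology.IsBounded (spaceTime Ω T) := by
  obtain ⟨R, hR⟩ := hS.subset_closedBall 0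
  refine ((Metric.isBounded_Icc (-R) R).prod (Metric.isBounded_Icc 0 T)).subset ?_
  rintro ⟨x, t⟩ ⟨ht, hx⟩
  have hb := (hΩ t (Ioo_subset_Icc_self ht)).2
  obtain ⟨y, hy, hxy⟩ := exists_mem_frontier_ge hb.bddAbove hx
  obtain ⟨w, hw, hwx⟩ := exists_mem_frontier_le hb.bddBelow hx
  have h1 := hR (show (y, t) ∈ lateral Ω T from ⟨ht, hy⟩)
  have h2 := hR (show (w, t) ∈ lateral Ω T from ⟨ht, hw⟩)
  rw [mem_closedBall_zero_iff] at h1 h2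
  have h3 := (norm_fst_le _).trans h1
  have h4 := (norm_fst_le _).trans h2
  rw [Real.norm_eq_abs, abs_le] at h3 h4
  exact ⟨⟨h4.1.trans hwx, hxy.trans h3.2⟩, Ioo_subset_Icc_self ht⟩

lemma mem_uIoo_of_notMem {a b c y : ℝ} (hc : c ∈ uIoo a b) (hy : y ∈ uIoo a b) (hne : y ≠ c)
    (hn : y ∉ uIoo a c) : y ∈ uIoo c b := by
  simp only [uIoo_eq_union, mem_union, mem_Ioo] at *
  grind

/-- What the analysis uses of the lateral charts: off a finite set of times the time slices have
uniformly separated boundaries, and the lateral boundary lies on finitely many Lipschitz curves. -/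
structure HasLateralCurves (Ω : ℝ → Set ℝ) (T δ : ℝ) (F : Set ℝ) {N : ℕ} (K : ℝ≥0)
    (c : Fin N → ℝ → ℝ) : Prop where
  isOpen : IsOpen (spaceTime Ω T)
  isBounded : Bornology.IsBounded (spaceTime Ω T)
  pos : 0 < δ
  finite : F.Finite
  separated : ∀ t ∉ F, HasSeparatedBoundary δ (timeSlice (spaceTime Ω T) t)
  lipschitz : ∀ i, LipschitzWith K (c i)
  mem_graph : ∀ z ∈ lateral Ω T, ∃ i, z.1 = c i z.2

/-- The exceptional times are the end points of the chart intervals: at any other time a boundary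
point lies on a curve `c i` with `t` interior to `[α i, β i]`, so both sides of the strip are
available. -/
theorem exists_hasLateralCurves {Ω : ℝ → Set ℝ} {T CΩ CdΩ : ℝ}
    (hΩ : ∀ t ∈ Icc 0 T, IsOpen (Ω t) ∧ Bornology.IsBounded (Ω t))
    (hQ : IsOpen (spaceTime Ω T)) (hB : UniformBounds Ω T CΩ CdΩ)
    (hC : HasLateralCharts (spaceTime Ω T) (lateral Ω T)) :
    ∃ (δ : ℝ) (F : Set ℝ) (N : ℕ) (K : ℝ≥0) (c : Fin N → ℝ → ℝ),
      HasLateralCurves Ω T δ F K c := by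
  obtain ⟨N, O, α, β, h, ⟨V, -, hSV, hVO⟩, H⟩ := hC
  choose δ K a c b hδ hs using fun i => (H i).exists_isLateralStrip hQ
  obtain ⟨δ₀, hδ₀, hδ₀'⟩ : ∃ δ₀ > 0, ∀ i, δ₀ ≤ δ i := by
    have h1 : ∀ᶠ d in 𝓝[>] (0 : ℝ), ∀ i, d ≤ δ i := eventually_all.2 fun i =>
      nhdsWithin_le_nhds ((eventually_lt_nhds (hδ i)).mono fun _ => le_of_lt)
    obtain ⟨d, hd1, hd2⟩ := (h1.and self_mem_nhdsWithin).exists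
    exact ⟨d, hd2, hd1⟩
  have hfin : ∀ t ∈ Icc 0 T, (frontier (Ω t)).Finite := fun t ht =>
    Measure.count_apply_lt_top.1 ((hB t ht).2.trans_lt ENNReal.ofReal_lt_top)
  have hmemO : ∀ z ∈ lateral Ω T, ∃ i, z ∈ O i := fun z hz => mem_iUnion.1 (hVO (hSV hz))
  refine ⟨δ₀, range α ∪ range β, N, Finset.univ.sup K, c, hQ, ?_, hδ₀,
    (finite_range α).union (finite_range β), ?_, ?_, ?_⟩
  · refine isBounded_spaceTime hΩ (Bornology.IsBounded.subset ?_ (hSV.trans hVO))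
    exact Bornology.isBounded_iUnion.2 fun i => (H i).isBounded
  · intro t ht
    by_cases ht0 : t ∈ Ioo 0 T
    swap
    · rw [timeSlice_spaceTime_of_notMem ht0]
      exact ⟨isOpen_empty, Bornology.isBounded_empty, by simp, by simp, by simp⟩
    rw [timeSlice_spaceTime ht0]
    have ht1 := Ioo_subset_Icc_self ht0
    have hchart : ∀ x ∈ frontier (Ω t), ∃ i, t ∈ Ioo (α i) (β i) ∧ x = c i t := by
      intro x hx
      have hxS : (x, t) ∈ lateral Ω T := ⟨ht0, hx⟩
      obtain ⟨i, hi⟩ := hmemO _ hxS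
      have hst := (H i).strip _ hi
      refine ⟨i, ⟨lt_of_le_of_ne hst.1 fun he => ht (Or.inl ⟨i, he⟩),
        lt_of_le_of_ne hst.2 fun he => ht (Or.inr ⟨i, he.symm⟩)⟩, ?_⟩
      exact (hs i).mem_graph _ ⟨hxS, hi⟩
    have hout : ∀ i, t ∈ Ioo (α i) (β i) → Disjoint (uIoo (a i t) (c i t)) (Ω t) :=
      fun i hi => disjoint_left.2 fun x hx hxΩ => (hs i).outer_notMem t hi x hx ⟨ht0, hxΩ⟩
    refine ⟨(hΩ t ht1).1, (hΩ t ht1).2, hfin t ht1, ?_, ?_⟩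
    · intro x hx
      obtain ⟨i, hi, rfl⟩ := hchart x hx
      refine ⟨b i t, (hδ₀' i).trans ((hs i).inner_dist t hi), ?_⟩
      -- Points of `Ω t` accumulate at `c i t`, which is not in the open set `Ω t`. The outer side
      -- contains none of them, so they are on the inner side.
      have hne : (uIoo (c i t) (b i t) ∩ Ω t).Nonempty := by
        obtain ⟨y, hy, hyΩ⟩ := mem_closure_iff.1 (frontier_subset_closure hx) _
          (isOpen_Ioo : IsOpen (uIoo (a i t) (b i t))) ((hs i).between t hi)
        refine ⟨y, mem_uIoo_of_notMem ((hs i).between t hi) hy ?_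
          fun h' => disjoint_left.1 (hout i hi) h' hyΩ, hyΩ⟩
        rintro rfl
        rw [(hΩ t ht1).1.frontier_eq] at hx
        exact hx.2 hyΩ
      -- The strip only places the inner interval in `closure Q`. If it were not contained in `Ω t`,
      -- it would contain a boundary point `c j t`, and hence points of the outer region of the
      -- chart `j`. That region is open and misses `Q`, so it cannot meet `closure Q`.
      by_contra hsub
      obtain ⟨w, hw, hwΩ⟩ := not_subset.1 hsub
      obtain ⟨y, hy, hyf⟩ := (isPreconnected_Ioo :
        IsPreconnected (uIoo (c i t) (b i t))).inter_frontier_nonempty hne ⟨w, hw, hwΩ⟩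
      obtain ⟨j, hj, rfl⟩ := hchart y hyf
      have hcl : c j t ∈ closure (uIoo (a j t) (c j t)) := by
        have hne' : a j t ≠ c j t := fun he => by
          have := (hs j).outer_dist t hj
          rw [he, sub_self, abs_zero] at this
          linarith [hδ j]
        rw [uIoo, closure_Ioo (by simpa using hne')]
        exact right_mem_uIcc
      obtain ⟨v, hv1, hv2⟩ := mem_closure_iff.1 hcl _ (isOpen_Ioo :
        IsOpen (uIoo (c i t) (b i t))) hy
      obtain ⟨z, hz, hzQ⟩ := mem_closure_iff.1 ((hs i).inner_mem t hi v hv1) _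
        (hs j).isOpen_outer ⟨hj, hv2⟩
      exact (hs j).outer_notMem z.2 hz.1 z.1 hz.2 hzQ
    · intro x hx
      obtain ⟨i, hi, rfl⟩ := hchart x hx
      exact ⟨a i t, (hδ₀' i).trans ((hs i).outer_dist t hi), uIoo_comm (a i t) (c i t) ▸ hout i hi⟩
  · exact fun i => (hs i).lipschitz.weaken (Finset.le_sup (Finset.mem_univ i))
  · intro z hz
    obtain ⟨i, hi⟩ := hmemO z hz
    exact ⟨i, (hs i).mem_graph z ⟨hz, hi⟩⟩

/-! ### Arc length compared with the time variable -/

lemma arcLength_apply {S E : Set (ℝ × ℝ)} (hS : MeasurableSet S) (hE : MeasurableSet E) :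
    arcLength S E =
      (Measure.hausdorffMeasure 1 : Measure (WithLp 2 (ℝ × ℝ))) (WithLp.ofLp ⁻¹' (E ∩ S)) := by
  rw [arcLength, Measure.restrict_apply hE, Measure.map_apply ?_ (hE.inter hS)]
  exact (WithLp.prod_continuous_ofLp 2 ℝ ℝ).measurable

lemma lipschitzWith_graph {K : ℝ≥0} {c : ℝ → ℝ} (hc : LipschitzWith K c) :
    LipschitzWith (K + 1) fun t : ℝ => WithLp.toLp 2 (c t, t) := by
  refine LipschitzWith.of_dist_le_mul fun s t => ?_
  rw [WithLp.prod_dist_eq_of_L2]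
  have h1 := hc.dist_le_mul s t
  have h2 : (0 : ℝ) ≤ dist s t := dist_nonneg
  have h3 : (0 : ℝ) ≤ dist (c s) (c t) := dist_nonneg
  have h4 : (0 : ℝ) ≤ K := K.2
  refine Real.sqrt_le_iff.2 ⟨by positivity, ?_⟩
  change dist (c s) (c t) ^ 2 + dist s t ^ 2 ≤ _
  push_cast
  nlinarith [pow_le_pow_left₀ h3 h1 2, mul_nonneg h4 (sq_nonneg (dist s t))]

lemma lipschitzWith_snd_ofLp :
    LipschitzWith 1 fun w : WithLp 2 (ℝ × ℝ) => (WithLp.ofLp w).2 := by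
  refine LipschitzWith.of_dist_le_mul fun v w => ?_
  rw [WithLp.prod_dist_eq_of_L2, NNReal.coe_one, one_mul]
  refine Real.le_sqrt_of_sq_le ?_
  simp only [WithLp.snd]
  exact le_add_of_nonneg_left (sq_nonneg _)

lemma continuous_graph {K : ℝ≥0} {c : ℝ → ℝ} (hc : LipschitzWith K c) :
    Continuous fun t : ℝ => (c t, t) := hc.continuous.prodMk continuous_id

/-- The arc length of a set covered by Lipschitz graphs is controlled by the time variable. -/
lemma lintegral_arcLength_le {S : Set (ℝ × ℝ)} (hS : MeasurableSet S) {N : ℕ} {K : ℝ≥0}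
    {c : Fin N → ℝ → ℝ} (hc : ∀ i, LipschitzWith K (c i)) (hSc : ∀ z ∈ S, ∃ i, z.1 = c i z.2)
    {ψ : ℝ × ℝ → ℝ≥0∞} (hψ : Measurable ψ) :
    ∫⁻ z, ψ z ∂arcLength S ≤
      (K + 1) * ∑ i, ∫⁻ t in {t | (c i t, t) ∈ S}, ψ (c i t, t) := by
  have hm : ∀ i, MeasurableSet {t | (c i t, t) ∈ S} := fun i =>
    (continuous_graph (hc i)).measurable hS
  have hle : arcLength S ≤ ((K : ℝ≥0∞) + 1) • ∑ i : Fin N,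
      (volume.restrict {t | (c i t, t) ∈ S}).map fun t => (c i t, t) := by
    refine Measure.le_iff.2 fun E hE => ?_
    have hm' : ∀ i, MeasurableSet ((fun t => (c i t, t)) ⁻¹' E) := fun i =>
      (continuous_graph (hc i)).measurable hE
    rw [arcLength_apply hS hE]
    have hsub : WithLp.ofLp ⁻¹' (E ∩ S) ⊆ ⋃ i : Fin N,
        (fun t : ℝ => WithLp.toLp 2 (c i t, t)) ''
          ((fun t => (c i t, t)) ⁻¹' E ∩ {t | (c i t, t) ∈ S}) := by
      intro w hw
      obtain ⟨i, hi⟩ := hSc _ hw.2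
      have he : (c i (WithLp.ofLp w).2, (WithLp.ofLp w).2) = WithLp.ofLp w :=
        Prod.ext hi.symm rfl
      refine mem_iUnion.2 ⟨i, (WithLp.ofLp w).2, ⟨?_, ?_⟩, ?_⟩
      · rw [mem_preimage, he]
        exact hw.1
      · rw [mem_ofPred, he]
        exact hw.2
      · beta_reduce
        rw [he]
    refine (measure_mono hsub).trans ((measure_iUnion_fintype_le _ _).trans ?_)
    rw [Measure.smul_apply, Measure.finsetSum_apply, smul_eq_mul, Finset.mul_sum]
    refine Finset.sum_le_sum fun i _ => ?_
    refine ((lipschitzWith_graph (hc i)).hausdorffMeasure_image_le zero_le_one _).trans ?_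
    rw [hausdorffMeasure_real, Measure.map_apply (continuous_graph (hc i)).measurable hE,
      Measure.restrict_apply (hm' i), ENNReal.rpow_one]
    push_cast
    exact le_rfl
  refine (lintegral_mono' hle le_rfl).trans ?_
  rw [lintegral_smul_measure, lintegral_finsetSum_measure, smul_eq_mul]
  refine mul_le_mul_right (Finset.sum_le_sum fun i _ => ?_) _
  rw [lintegral_map hψ (continuous_graph (hc i)).measurable]

/-- The times at which the `i`-th graph meets `S`, at a point which is on no earlier graph. -/
def firstGraphTimes (S : Set (ℝ × ℝ)) {N : ℕ} (c : Fin N → ℝ → ℝ) (i : Fin N) : Set ℝ :=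
  {t | (c i t, t) ∈ S ∧ ∀ j < i, c j t ≠ c i t}

lemma measurableSet_firstGraphTimes {S : Set (ℝ × ℝ)} (hS : MeasurableSet S) {N : ℕ} {K : ℝ≥0}
    {c : Fin N → ℝ → ℝ} (hc : ∀ i, LipschitzWith K (c i)) (i : Fin N) :
    MeasurableSet (firstGraphTimes S c i) := by
  refine MeasurableSet.inter ((continuous_graph (hc i)).measurable hS) ?_
  have h1 : {t : ℝ | ∀ j < i, c j t ≠ c i t} =
      ⋂ j : Fin N, ⋂ _ : j < i, {t : ℝ | c j t = c i t}ᶜ := by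
    ext t
    simp
  change MeasurableSet {t : ℝ | ∀ j < i, c j t ≠ c i t}
  rw [h1]
  exact MeasurableSet.iInter fun j => MeasurableSet.iInter fun _ =>
    (isClosed_eq (hc j).continuous (hc i).continuous).measurableSet.compl

/-- Projecting to the time variable does not increase arc length, with multiplicities. -/
lemma sum_lintegral_le_lintegral_arcLength {S : Set (ℝ × ℝ)} (hS : MeasurableSet S) {N : ℕ}
    {K : ℝ≥0} {c : Fin N → ℝ → ℝ} (hc : ∀ i, LipschitzWith K (c i))
    {ψ : ℝ × ℝ → ℝ≥0∞} (hψ : Measurable ψ) :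
    ∑ i, ∫⁻ t in firstGraphTimes S c i, ψ (c i t, t) ≤ ∫⁻ z, ψ z ∂arcLength S := by
  have hP := measurableSet_firstGraphTimes hS hc
  have hle : ∑ i : Fin N, (volume.restrict (firstGraphTimes S c i)).map (fun t => (c i t, t)) ≤
      arcLength S := by
    refine Measure.le_iff.2 fun E hE => ?_
    -- The graphs may cross or coincide. Keeping each point only on its first graph makes these
    -- pieces disjoint, so their arc lengths add up to at most that of `E ∩ S`.
    set G : Fin N → Set (ℝ × ℝ) := fun i =>
      E ∩ ({z | z.1 = c i z.2} ∩ Prod.snd ⁻¹' firstGraphTimes S c i) with hG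
    have hGm : ∀ i, MeasurableSet (G i) := fun i => hE.inter
      ((isClosed_eq continuous_fst ((hc i).continuous.comp continuous_snd)).measurableSet.inter
        (measurable_snd (hP i)))
    have hdisj : Pairwise (Function.onFun Disjoint fun i =>
        (WithLp.ofLp ⁻¹' G i : Set (WithLp 2 (ℝ × ℝ)))) := by
      have key : ∀ i j, i < j → Disjoint (G i) (G j) := by
        intro i j hij
        refine disjoint_left.2 fun z hi hj => ?_
        exact hj.2.2.2 i hij (hi.2.1.symm.trans hj.2.1)
      intro i j hij
      refine Disjoint.preimage _ ?_
      rcases lt_or_gt_of_ne hij with h | h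
      · exact key i j h
      · exact (key j i h).symm
    have hsub : (⋃ i, (WithLp.ofLp ⁻¹' G i : Set (WithLp 2 (ℝ × ℝ)))) ⊆
        WithLp.ofLp ⁻¹' (E ∩ S) := by
      refine iUnion_subset fun i w hw => ⟨hw.1, ?_⟩
      have he : (c i (WithLp.ofLp w).2, (WithLp.ofLp w).2) = WithLp.ofLp w :=
        Prod.ext hw.2.1.symm rfl
      rw [← he]
      exact hw.2.2.1
    rw [arcLength_apply hS hE, Measure.finsetSum_apply]
    refine le_trans ?_ (measure_mono hsub)
    rw [measure_iUnion hdisj fun i => (WithLp.prod_continuous_ofLp 2 ℝ ℝ).measurable (hGm i),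
      tsum_fintype]
    refine Finset.sum_le_sum fun i _ => ?_
    rw [Measure.map_apply (continuous_graph (hc i)).measurable hE,
      Measure.restrict_apply ((continuous_graph (hc i)).measurable hE)]
    have him : (fun t => (c i t, t)) ⁻¹' E ∩ firstGraphTimes S c i ⊆
        (fun w : WithLp 2 (ℝ × ℝ) => (WithLp.ofLp w).2) '' (WithLp.ofLp ⁻¹' G i) :=
      fun t ht => ⟨WithLp.toLp 2 (c i t, t), ⟨ht.1, rfl, ht.2⟩, rfl⟩
    refine (measure_mono him).trans ?_
    rw [← hausdorffMeasure_real]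
    simpa using lipschitzWith_snd_ofLp.hausdorffMeasure_image_le zero_le_one
      (WithLp.ofLp ⁻¹' G i : Set (WithLp 2 (ℝ × ℝ)))
  refine le_trans (le_of_eq ?_) (lintegral_mono' hle le_rfl)
  rw [lintegral_finsetSum_measure]
  refine Finset.sum_congr rfl fun i _ => ?_
  rw [lintegral_map hψ (continuous_graph (hc i)).measurable]

/-- Each point of the slice is attached to the smallest index of a graph through it; distinct points
get distinct indices. -/
lemma sum_frontier_le_sum_indicator {S : Set (ℝ × ℝ)} {N : ℕ} {c : Fin N → ℝ → ℝ}
    (hSc : ∀ z ∈ S, ∃ i, z.1 = c i z.2) (ψ : ℝ × ℝ → ℝ≥0∞) {t : ℝ} (s : Finset ℝ)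
    (hs : ∀ x ∈ s, (x, t) ∈ S) :
    ∑ x ∈ s, ψ (x, t) ≤ ∑ i, (firstGraphTimes S c i).indicator (fun t => ψ (c i t, t)) t := by
  classical
  have hex : ∀ x ∈ s, ∃ i, c i t = x ∧ t ∈ firstGraphTimes S c i := by
    intro x hx
    have hne : (Finset.univ.filter fun i => c i t = x).Nonempty := by
      obtain ⟨i, hi⟩ := hSc _ (hs x hx)
      exact ⟨i, by simpa using hi.symm⟩
    have hmin := Finset.min'_mem _ hne
    set i := Finset.min' _ hne
    have hi : c i t = x := by simpa using hmin
    refine ⟨i, hi, ?_, fun j hj he => ?_⟩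
    · rw [hi]
      exact hs x hx
    · exact absurd (Finset.min'_le _ j (by simpa using he.trans hi)) (not_le.2 hj)
  rcases s.eq_empty_or_nonempty with rfl | ⟨x₀, hx₀⟩
  · simp
  have : Nonempty (Fin N) := ⟨(hex x₀ hx₀).choose⟩
  choose! f hf1 hf2 using hex
  have hinj : InjOn f s := fun x hx y hy h => by rw [← hf1 x hx, ← hf1 y hy, h]
  calc ∑ x ∈ s, ψ (x, t)
      = ∑ i ∈ s.image f, (firstGraphTimes S c i).indicator (fun t => ψ (c i t, t)) t := by
        rw [Finset.sum_image hinj]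
        refine Finset.sum_congr rfl fun x hx => ?_
        rw [indicator_of_mem (hf2 x hx), hf1 x hx]
    _ ≤ _ := Finset.sum_le_sum_of_subset (Finset.subset_univ _)

/-! ### Estimates on intervals and on a single slice -/

lemma ENNReal.add_sq_le_two_mul (a b : ℝ≥0∞) : (a + b) ^ 2 ≤ 2 * a ^ 2 + 2 * b ^ 2 := by
  induction a with
  | top => simp
  | coe a =>
    induction b with
    | top => simp
    | coe b =>
      norm_cast
      rw [← NNReal.coe_le_coe]
      push_cast
      nlinarith [sq_nonneg ((a : ℝ) - b)]

lemma sq_lintegral_le {α : Type*} [MeasurableSpace α] (μ : Measure α) {f : α → ℝ≥0∞}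
    (hf : AEMeasurable f μ) : (∫⁻ x, f x ∂μ) ^ 2 ≤ μ univ * ∫⁻ x, f x ^ 2 ∂μ := by
  have h := ENNReal.lintegral_mul_le_Lp_mul_Lq μ Real.HolderConjugate.two_two
    (aemeasurable_const (b := (1 : ℝ≥0∞))) hf
  simp only [Pi.mul_apply, one_mul, ENNReal.one_rpow, lintegral_one] at h
  calc (∫⁻ x, f x ∂μ) ^ 2
      ≤ (μ univ ^ (1 / 2 : ℝ) * (∫⁻ x, f x ^ (2 : ℝ) ∂μ) ^ (1 / 2 : ℝ)) ^ 2 := by gcongr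
    _ = _ := by
      rw [mul_pow, ← ENNReal.rpow_natCast, ← ENNReal.rpow_natCast, ← ENNReal.rpow_mul,
        ← ENNReal.rpow_mul]
      norm_num

/-- With values in `ℝ≥0∞` no integrability of `q` is needed, because the bound is trivial when the
right side is infinite. -/
lemma enorm_sub_le_lintegral_deriv {a b : ℝ} {p q : ℝ → ℝ} (hp : ContinuousOn p (Icc a b))
    (hq : Measurable q) (hd : ∀ x ∈ Ioo a b, HasDerivAt p (q x) x) {x y : ℝ}
    (hx : x ∈ Icc a b) (hy : y ∈ Icc a b) :
    ‖p y - p x‖ₑ ≤ ∫⁻ s in Ioo a b, ‖q s‖ₑ := by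
  wlog hxy : x ≤ y generalizing x y
  · rw [← neg_sub, enorm_neg]
    exact this hy hx (le_of_not_ge hxy)
  by_cases htop : ∫⁻ s in Ioo a b, ‖q s‖ₑ = ⊤
  · rw [htop]; exact le_top
  have hint : IntegrableOn q (Ioo a b) := ⟨hq.aestronglyMeasurable, lt_top_iff_ne_top.2 htop⟩
  have hsub : Ioo x y ⊆ Ioo a b := Ioo_subset_Ioo hx.1 hy.2
  have hint' : IntervalIntegrable q volume x y :=
    (intervalIntegrable_iff_integrableOn_Ioo_of_le hxy).2 (hint.mono_set hsub)
  rw [← intervalIntegral.integral_eq_sub_of_hasDerivAt_of_le hxy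
    (hp.mono (Icc_subset_Icc hx.1 hy.2)) (fun s hs => hd s (hsub hs)) hint',
    intervalIntegral.integral_of_le hxy, integral_Ioc_eq_integral_Ioo]
  exact (enorm_integral_le_lintegral_enorm _).trans (lintegral_mono_set hsub)

/-- The common source of both estimates: integrating in `x` gives the trace bound, integrating in
`y` the Poincaré bound. -/
lemma enorm_sq_le_of_hasDerivAt {a b : ℝ} {p q : ℝ → ℝ} (hp : ContinuousOn p (Icc a b))
    (hq : Measurable q) (hd : ∀ x ∈ Ioo a b, HasDerivAt p (q x) x) {x y : ℝ}
    (hx : x ∈ Icc a b) (hy : y ∈ Icc a b) :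
    ‖p y‖ₑ ^ 2 ≤ 2 * ‖p x‖ₑ ^ 2 + 2 * (ENNReal.ofReal (b - a) * ∫⁻ s in Ioo a b, ‖q s‖ₑ ^ 2) := by
  have h1 : ‖p y‖ₑ ≤ ‖p x‖ₑ + ‖p y - p x‖ₑ := by
    calc ‖p y‖ₑ = ‖p x + (p y - p x)‖ₑ := by rw [add_sub_cancel]
      _ ≤ _ := enorm_add_le _ _
  have h2 := enorm_sub_le_lintegral_deriv hp hq hd hx hy
  have h3 := sq_lintegral_le (volume.restrict (Ioo a b)) (f := fun s => ‖q s‖ₑ)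
    hq.enorm.aemeasurable
  rw [Measure.restrict_apply_univ, Real.volume_Ioo] at h3
  calc ‖p y‖ₑ ^ 2 ≤ (‖p x‖ₑ + ‖p y - p x‖ₑ) ^ 2 := by gcongr
    _ ≤ 2 * ‖p x‖ₑ ^ 2 + 2 * ‖p y - p x‖ₑ ^ 2 := ENNReal.add_sq_le_two_mul _ _
    _ ≤ 2 * ‖p x‖ₑ ^ 2 + 2 * (∫⁻ s in Ioo a b, ‖q s‖ₑ) ^ 2 := by gcongr
    _ ≤ _ := by gcongr

/-- The value at any point of an interval is controlled by the `H¹` norm. -/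
lemma ofReal_mul_enorm_sq_le {a b : ℝ} {p q : ℝ → ℝ} (hp : ContinuousOn p (Icc a b))
    (hq : Measurable q) (hd : ∀ x ∈ Ioo a b, HasDerivAt p (q x) x) {x : ℝ}
    (hx : x ∈ Icc a b) :
    ENNReal.ofReal (b - a) * ‖p x‖ₑ ^ 2 ≤ 2 * (∫⁻ s in Ioo a b, ‖p s‖ₑ ^ 2) +
      2 * (ENNReal.ofReal (b - a) ^ 2 * ∫⁻ s in Ioo a b, ‖q s‖ₑ ^ 2) := by
  calc ENNReal.ofReal (b - a) * ‖p x‖ₑ ^ 2 = ∫⁻ _ in Ioo a b, ‖p x‖ₑ ^ 2 := by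
        rw [setLIntegral_const, Real.volume_Ioo, mul_comm]
    _ ≤ ∫⁻ y in Ioo a b, (2 * ‖p y‖ₑ ^ 2 +
          2 * (ENNReal.ofReal (b - a) * ∫⁻ s in Ioo a b, ‖q s‖ₑ ^ 2)) :=
        setLIntegral_mono' measurableSet_Ioo fun y hy =>
          enorm_sq_le_of_hasDerivAt hp hq hd (Ioo_subset_Icc_self hy) hx
    _ = _ := by
        rw [lintegral_add_right _ measurable_const, lintegral_const_mul' _ _ (by simp),
          setLIntegral_const, Real.volume_Ioo]
        ring

/-- The `L²` norm on an interval is controlled by the value at a point and the derivative. -/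
lemma lintegral_enorm_sq_le {a b : ℝ} {p q : ℝ → ℝ} (hp : ContinuousOn p (Icc a b))
    (hq : Measurable q) (hd : ∀ x ∈ Ioo a b, HasDerivAt p (q x) x) {x : ℝ}
    (hx : x ∈ Icc a b) :
    ∫⁻ s in Ioo a b, ‖p s‖ₑ ^ 2 ≤ 2 * (ENNReal.ofReal (b - a) * ‖p x‖ₑ ^ 2) +
      2 * (ENNReal.ofReal (b - a) ^ 2 * ∫⁻ s in Ioo a b, ‖q s‖ₑ ^ 2) := by
  calc ∫⁻ s in Ioo a b, ‖p s‖ₑ ^ 2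
      ≤ ∫⁻ _ in Ioo a b, (2 * ‖p x‖ₑ ^ 2 +
          2 * (ENNReal.ofReal (b - a) * ∫⁻ s in Ioo a b, ‖q s‖ₑ ^ 2)) :=
        setLIntegral_mono' measurableSet_Ioo fun y hy =>
          enorm_sq_le_of_hasDerivAt hp hq hd hx (Ioo_subset_Icc_self hy)
    _ = _ := by
        rw [setLIntegral_const, Real.volume_Ioo]
        ring

/-- A bounded open set with finite boundary is a finite disjoint union of intervals. -/
lemma exists_finset_Ioo {A : Set ℝ} (hA : IsOpen A) (hb : Bornology.IsBounded A)
    (hf : (frontier A).Finite) : ∃ (s : Finset ℝ) (b : ℝ → ℝ),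
      (∀ x ∈ s, x ∈ frontier A ∧ b x ∈ frontier A ∧ x < b x ∧ Ioo x (b x) ⊆ A) ∧
      (s : Set ℝ).PairwiseDisjoint (fun x => Ioo x (b x)) ∧ A = ⋃ x ∈ s, Ioo x (b x) := by
  classical
  have hnot : ∀ x ∈ frontier A, x ∉ A := fun x hx => by
    rw [hA.frontier_eq] at hx
    exact hx.2
  -- The left end points of the components index them.
  set s := hf.toFinset.filter fun x => ∃ b ∈ frontier A, x < b ∧ Ioo x b ⊆ A with hs
  have hex : ∀ x ∈ s, ∃ b ∈ frontier A, x < b ∧ Ioo x b ⊆ A := fun x hx =>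
    (Finset.mem_filter.1 hx).2
  have hfr : ∀ x ∈ s, x ∈ frontier A := fun x hx => by simpa using (Finset.mem_filter.1 hx).1
  choose! b hb1 hb2 hb3 using hex
  refine ⟨s, b, fun x hx => ⟨hfr x hx, hb1 x hx, hb2 x hx, hb3 x hx⟩, ?_, ?_⟩
  · have key : ∀ x ∈ s, ∀ y ∈ s, x < y → Disjoint (Ioo x (b x)) (Ioo y (b y)) := by
      intro x hx y hy hxy
      have : b x ≤ y := by
        by_contra hlt
        exact hnot y (hfr y hy) (hb3 x hx ⟨hxy, not_le.1 hlt⟩)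
      exact disjoint_left.2 fun z hz hz' => absurd (hz.2.trans_le this) (not_lt.2 hz'.1.le)
    intro x hx y hy hxy
    rcases lt_or_gt_of_ne hxy with h | h
    · exact key x hx y hy h
    · exact (key y hy x hx h).symm
  · refine Subset.antisymm (fun y hy => ?_) (iUnion₂_subset fun x hx => hb3 x hx)
    have hL : (hf.toFinset.filter (· ≤ y)).Nonempty := by
      obtain ⟨w, hw, hwy⟩ := exists_mem_frontier_le hb.bddBelow hy
      exact ⟨w, by simp [hw, hwy]⟩
    have hR : (hf.toFinset.filter (y ≤ ·)).Nonempty := by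
      obtain ⟨w, hw, hwy⟩ := exists_mem_frontier_ge hb.bddAbove hy
      exact ⟨w, by simp [hw, hwy]⟩
    obtain ⟨hx1, hx2⟩ := Finset.mem_filter.1 (Finset.max'_mem _ hL)
    obtain ⟨hz1, hz2⟩ := Finset.mem_filter.1 (Finset.min'_mem _ hR)
    set x := Finset.max' _ hL with hxdef
    set z := Finset.min' _ hR with hzdef
    rw [Set.Finite.mem_toFinset] at hx1 hz1
    have hxy : x < y := lt_of_le_of_ne hx2 fun h => hnot x hx1 (h ▸ hy)
    have hyz : y < z := lt_of_le_of_ne hz2 fun h => hnot z hz1 (h ▸ hy)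
    have hsub : Ioo x z ⊆ A := by
      by_contra hns
      obtain ⟨w, hw, hwA⟩ := not_subset.1 hns
      obtain ⟨v, hv, hvf⟩ := (isPreconnected_Ioo (a := x) (b := z)).inter_frontier_nonempty
        ⟨y, ⟨hxy, hyz⟩, hy⟩ ⟨w, hw, hwA⟩
      rcases le_total v y with h | h
      · exact absurd (Finset.le_max' _ v (by simp [hvf, h])) (not_le.2 hv.1)
      · exact absurd (Finset.min'_le _ v (by simp [hvf, h])) (not_le.2 hv.2)
    have hxs : x ∈ s := Finset.mem_filter.2 ⟨by simpa using hx1, z, hz1, hxy.trans hyz, hsub⟩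
    -- The chosen right end `b x` is not known to be `z`, but `b x ≤ y` would put a boundary point
    -- inside `Ioo x z ⊆ A`.
    refine mem_iUnion₂.2 ⟨x, hxs, hxy, ?_⟩
    by_contra hle
    exact hnot _ (hb1 x hxs) (hsub ⟨hb2 x hxs, (not_lt.1 hle).trans_lt hyz⟩)

lemma HasSeparatedBoundary.ofReal_mul_enorm_sq_le {δ : ℝ} {A : Set ℝ} (hδ : 0 < δ)
    (hA : HasSeparatedBoundary δ A) {p q : ℝ → ℝ} (hp : ContinuousOn p (closure A))
    (hq : Measurable q) (hd : ∀ x ∈ A, HasDerivAt p (q x) x) {x : ℝ} (hx : x ∈ frontier A) :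
    ENNReal.ofReal δ * ‖p x‖ₑ ^ 2 ≤ 2 * (∫⁻ s in A, ‖p s‖ₑ ^ 2) +
      2 * (ENNReal.ofReal δ ^ 2 * ∫⁻ s in A, ‖q s‖ₑ ^ 2) := by
  have key : ∀ a b : ℝ, b - a = δ → Ioo a b ⊆ A → x ∈ Icc a b →
      ENNReal.ofReal δ * ‖p x‖ₑ ^ 2 ≤ 2 * (∫⁻ s in A, ‖p s‖ₑ ^ 2) +
      2 * (ENNReal.ofReal δ ^ 2 * ∫⁻ s in A, ‖q s‖ₑ ^ 2) := by
    intro a b hab hsub hxI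
    have hcl : Icc a b ⊆ closure A := by
      rw [← closure_Ioo (by linarith : a ≠ b)]
      exact closure_mono hsub
    have h1 := _root_.ofReal_mul_enorm_sq_le (hp.mono hcl) hq (fun y hy => hd y (hsub hy)) hxI
    rw [hab] at h1
    refine h1.trans ?_
    gcongr
  obtain ⟨d, hdx, hsub⟩ := hA.exists_inner x hx
  rcases le_total x d with h | h
  · rw [abs_of_nonneg (by linarith)] at hdx
    rw [uIoo_of_le h] at hsub
    exact key x (x + δ) (by ring) ((Ioo_subset_Ioo_right (by linarith)).trans hsub)
      ⟨le_rfl, by linarith⟩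
  · rw [abs_of_nonpos (by linarith)] at hdx
    rw [uIoo_of_ge h] at hsub
    exact key (x - δ) x (by ring) ((Ioo_subset_Ioo_left (by linarith)).trans hsub)
      ⟨by linarith, le_rfl⟩

/-- The interval estimate is summed over the components, each started from its left end point. A
component is no longer than `volume A`, so neither `δ` nor the number of components enters the
constant. -/
lemma HasSeparatedBoundary.exists_lintegral_enorm_sq_le {δ : ℝ} {A : Set ℝ}
    (hA : HasSeparatedBoundary δ A) {C : ℝ≥0∞} (hC : volume A ≤ C) {p q : ℝ → ℝ}
    (hp : ContinuousOn p (closure A)) (hq : Measurable q) (hd : ∀ x ∈ A, HasDerivAt p (q x) x) :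
    ∃ s : Finset ℝ, (∀ x ∈ s, x ∈ frontier A) ∧ ∫⁻ y in A, ‖p y‖ₑ ^ 2 ≤
      2 * (C * ∑ x ∈ s, ‖p x‖ₑ ^ 2) + 2 * (C ^ 2 * ∫⁻ y in A, ‖q y‖ₑ ^ 2) := by
  obtain ⟨s, b, hs, hdisj, heq⟩ := exists_finset_Ioo hA.isOpen hA.isBounded hA.finite_frontier
  refine ⟨s, fun x hx => (hs x hx).1, ?_⟩
  have hsum : ∀ f : ℝ → ℝ≥0∞, ∫⁻ y in A, f y = ∑ x ∈ s, ∫⁻ y in Ioo x (b x), f y := fun f => by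
    rw [heq]
    exact lintegral_biUnion_finset hdisj (fun x _ => measurableSet_Ioo) f
  rw [hsum, hsum, Finset.mul_sum, Finset.mul_sum, Finset.mul_sum, Finset.mul_sum,
    ← Finset.sum_add_distrib]
  refine Finset.sum_le_sum fun x hx => ?_
  obtain ⟨-, -, hlt, hsub⟩ := hs x hx
  have hcl : Icc x (b x) ⊆ closure A := by
    rw [← closure_Ioo hlt.ne]
    exact closure_mono hsub
  have hlen : ENNReal.ofReal (b x - x) ≤ C := by
    rw [← Real.volume_Ioo]
    exact (measure_mono hsub).trans hC
  refine (lintegral_enorm_sq_le (hp.mono hcl) hq (fun y hy => hd y (hsub hy))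
    (left_mem_Icc.2 hlt.le)).trans ?_
  gcongr

/-! ### Integration over time of the slice estimates -/

lemma measurableSet_timeSlice {Q : Set (ℝ × ℝ)} (hQ : MeasurableSet Q) (t : ℝ) :
    MeasurableSet (timeSlice Q t) := (by fun_prop : Measurable fun x : ℝ => (x, t)) hQ

lemma setLIntegral_eq_lintegral_timeSlice {Q : Set (ℝ × ℝ)} (hQ : MeasurableSet Q)
    {ψ : ℝ × ℝ → ℝ≥0∞} (hψ : Measurable ψ) :
    ∫⁻ z in Q, ψ z = ∫⁻ t, ∫⁻ x in timeSlice Q t, ψ (x, t) := by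
  rw [← lintegral_indicator hQ, Measure.volume_eq_prod,
    lintegral_prod_symm _ (hψ.indicator hQ).aemeasurable]
  refine lintegral_congr fun t => ?_
  rw [← lintegral_indicator (measurableSet_timeSlice hQ t)]
  rfl

lemma measurable_lintegral_timeSlice {Q : Set (ℝ × ℝ)} (hQ : MeasurableSet Q)
    {ψ : ℝ × ℝ → ℝ≥0∞} (hψ : Measurable ψ) :
    Measurable fun t => ∫⁻ x in timeSlice Q t, ψ (x, t) := by
  have h1 := (hψ.indicator hQ).lintegral_prod_left' (μ := (volume : Measure ℝ))
  refine (congrArg Measurable (funext fun t => ?_)).mp h1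
  rw [← lintegral_indicator (measurableSet_timeSlice hQ t)]
  rfl

namespace HasLateralCurves

variable {Ω : ℝ → Set ℝ} {T δ : ℝ} {F : Set ℝ} {N : ℕ} {K : ℝ≥0} {c : Fin N → ℝ → ℝ}

lemma ae_notMem (h : HasLateralCurves Ω T δ F K c) : ∀ᵐ t : ℝ, t ∉ F :=
  h.finite.countable.ae_notMem volume

lemma continuousOn_timeSlice {Q : Set (ℝ × ℝ)} {φ : ℝ × ℝ → ℝ} (hφ : ContinuousOn φ (closure Q))
    (t : ℝ) : ContinuousOn (fun x => φ (x, t)) (closure (timeSlice Q t)) :=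
  hφ.comp (by fun_prop) fun _ hx => mem_closure_of_mem_closure_timeSlice hx

/-- The trace estimate for functions that are continuous up to the boundary. -/
theorem exists_lintegral_arcLength_le (h : HasLateralCurves Ω T δ F K c) :
    ∃ M : ℝ≥0, ∀ φ q : ℝ × ℝ → ℝ, Measurable φ → Measurable q →
      ContinuousOn φ (closure (spaceTime Ω T)) →
      (∀ z ∈ spaceTime Ω T, HasDerivAt (fun x => φ (x, z.2)) (q z) z.1) →
      ∫⁻ z, ‖φ z‖ₑ ^ 2 ∂arcLength (lateral Ω T) ≤
        M * ((∫⁻ z in spaceTime Ω T, ‖φ z‖ₑ ^ 2) + ∫⁻ z in spaceTime Ω T, ‖q z‖ₑ ^ 2) := by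
  set Q := spaceTime Ω T
  set S := lateral Ω T
  have hQm := h.isOpen.measurableSet
  have hSm : MeasurableSet S := measurableSet_lateral h.isOpen
  -- `m` is the constant of the slice estimate after division by `δ`. The full constant also has `K
  -- + 1` from arc length and `N` from the number of graphs.
  set m : ℝ≥0 := 2 * δ.toNNReal⁻¹ + 2 * δ.toNNReal with hm
  refine ⟨(K + 1) * (N * m), fun φ q hφ hq hc hd => ?_⟩
  have hδ : ENNReal.ofReal δ ≠ 0 := by simpa using h.pos
  have hpt : ∀ t ∉ F, ∀ x, (x, t) ∈ S → ‖φ (x, t)‖ₑ ^ 2 ≤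
      m * ((∫⁻ y in timeSlice Q t, ‖φ (y, t)‖ₑ ^ 2) + ∫⁻ y in timeSlice Q t, ‖q (y, t)‖ₑ ^ 2) := by
    intro t ht x hx
    have h1 := (h.separated t ht).ofReal_mul_enorm_sq_le h.pos (continuousOn_timeSlice hc t)
      (hq.comp (by fun_prop : Measurable fun x : ℝ => (x, t))) (fun y hy => hd (y, t) hy)
      (mem_lateral_iff.1 hx)
    set I := ∫⁻ y in timeSlice Q t, ‖φ (y, t)‖ₑ ^ 2
    set J : ℝ≥0∞ := ∫⁻ y in timeSlice Q t, ‖q (y, t)‖ₑ ^ 2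
    change ENNReal.ofReal δ * ‖φ (x, t)‖ₑ ^ 2 ≤ 2 * I + 2 * (ENNReal.ofReal δ ^ 2 * J) at h1
    calc ‖φ (x, t)‖ₑ ^ 2
        = (ENNReal.ofReal δ)⁻¹ * (ENNReal.ofReal δ * ‖φ (x, t)‖ₑ ^ 2) := by
          rw [← mul_assoc, ENNReal.inv_mul_cancel hδ ENNReal.ofReal_ne_top, one_mul]
      _ ≤ (ENNReal.ofReal δ)⁻¹ * (2 * I + 2 * (ENNReal.ofReal δ ^ 2 * J)) := by gcongr
      _ = 2 * (ENNReal.ofReal δ)⁻¹ * I +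
          2 * (((ENNReal.ofReal δ)⁻¹ * ENNReal.ofReal δ) * ENNReal.ofReal δ * J) := by ring
      _ = 2 * (ENNReal.ofReal δ)⁻¹ * I + 2 * ENNReal.ofReal δ * J := by
          rw [ENNReal.inv_mul_cancel hδ ENNReal.ofReal_ne_top, one_mul]
          ring
      _ ≤ (2 * (ENNReal.ofReal δ)⁻¹ + 2 * ENNReal.ofReal δ) * (I + J) := by
          rw [mul_add]
          exact add_le_add (mul_le_mul_left le_self_add _) (mul_le_mul_left le_add_self _)
      _ = m * (I + J) := by
          rw [hm, ENNReal.ofReal]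
          have : δ.toNNReal ≠ 0 := by simpa using h.pos
          push_cast [ENNReal.coe_inv this]
          rfl
  refine (lintegral_arcLength_le hSm h.lipschitz h.mem_graph (hφ.enorm.pow_const 2)).trans ?_
  have hmφ := measurable_lintegral_timeSlice hQm (hφ.enorm.pow_const 2)
  have hi : ∀ i, ∫⁻ t in {t | (c i t, t) ∈ S}, ‖φ (c i t, t)‖ₑ ^ 2 ≤
      m * ((∫⁻ z in Q, ‖φ z‖ₑ ^ 2) + ∫⁻ z in Q, ‖q z‖ₑ ^ 2) := by
    intro i
    calc ∫⁻ t in {t | (c i t, t) ∈ S}, ‖φ (c i t, t)‖ₑ ^ 2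
        ≤ ∫⁻ t in {t | (c i t, t) ∈ S}, m * ((∫⁻ y in timeSlice Q t, ‖φ (y, t)‖ₑ ^ 2) +
            ∫⁻ y in timeSlice Q t, ‖q (y, t)‖ₑ ^ 2) := by
          refine setLIntegral_mono_ae' ((continuous_graph (h.lipschitz i)).measurable hSm) ?_
          filter_upwards [h.ae_notMem] with t ht hx using hpt t ht _ hx
      _ ≤ ∫⁻ t, m * ((∫⁻ y in timeSlice Q t, ‖φ (y, t)‖ₑ ^ 2) +
            ∫⁻ y in timeSlice Q t, ‖q (y, t)‖ₑ ^ 2) := setLIntegral_le_lintegral _ _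
      _ = _ := by
          rw [lintegral_const_mul' _ _ ENNReal.coe_ne_top, lintegral_add_left hmφ,
            setLIntegral_eq_lintegral_timeSlice hQm (hφ.enorm.pow_const 2),
            setLIntegral_eq_lintegral_timeSlice hQm (hq.enorm.pow_const 2)]
  calc (↑K + 1) * ∑ i, ∫⁻ t in {t | (c i t, t) ∈ S}, ‖φ (c i t, t)‖ₑ ^ 2
      ≤ (↑K + 1) * ∑ _i : Fin N, m * ((∫⁻ z in Q, ‖φ z‖ₑ ^ 2) + ∫⁻ z in Q, ‖q z‖ₑ ^ 2) := by
        gcongr with i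
        exact hi i
    _ = _ := by
        rw [Finset.sum_const, Finset.card_univ, Fintype.card_fin, nsmul_eq_mul]
        push_cast
        ring

/-- The Poincaré inequality for functions that are continuous up to the boundary. -/
theorem lintegral_enorm_sq_le (h : HasLateralCurves Ω T δ F K c) {C : ℝ≥0∞} (hCt : C ≠ ⊤)
    (hC : ∀ t, volume (timeSlice (spaceTime Ω T) t) ≤ C) {φ q : ℝ × ℝ → ℝ} (hφ : Measurable φ)
    (hq : Measurable q) (hc : ContinuousOn φ (closure (spaceTime Ω T)))
    (hd : ∀ z ∈ spaceTime Ω T, HasDerivAt (fun x => φ (x, z.2)) (q z) z.1) :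
    ∫⁻ z in spaceTime Ω T, ‖φ z‖ₑ ^ 2 ≤
      2 * (C * ∫⁻ z, ‖φ z‖ₑ ^ 2 ∂arcLength (lateral Ω T)) +
        2 * (C ^ 2 * ∫⁻ z in spaceTime Ω T, ‖q z‖ₑ ^ 2) := by
  set Q := spaceTime Ω T
  set S := lateral Ω T
  have hQm := h.isOpen.measurableSet
  have hSm : MeasurableSet S := measurableSet_lateral h.isOpen
  have hψ : Measurable fun z => ‖φ z‖ₑ ^ 2 := hφ.enorm.pow_const 2
  -- `D t` dominates the sum of `|φ|²` over any finite set of boundary points of the slice, is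
  -- visibly measurable in `t`, and has integral at most that of `|φ|²` over arc length.
  set D : ℝ → ℝ≥0∞ := fun t =>
    ∑ i, (firstGraphTimes S c i).indicator (fun t => ‖φ (c i t, t)‖ₑ ^ 2) t with hD
  have hDi : ∀ i, Measurable
      ((firstGraphTimes S c i).indicator fun t => ‖φ (c i t, t)‖ₑ ^ 2) := fun i =>
    (hψ.comp (continuous_graph (h.lipschitz i)).measurable).indicator
      (measurableSet_firstGraphTimes hSm h.lipschitz i)
  have hDm : Measurable D := Finset.measurable_fun_sum _ fun i _ => hDi i
  have hDint : ∫⁻ t, D t ≤ ∫⁻ z, ‖φ z‖ₑ ^ 2 ∂arcLength S := by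
    refine le_trans (le_of_eq ?_) (sum_lintegral_le_lintegral_arcLength hSm h.lipschitz hψ)
    rw [hD, lintegral_finsetSum _ fun i _ => hDi i]
    exact Finset.sum_congr rfl fun i _ =>
      lintegral_indicator (measurableSet_firstGraphTimes hSm h.lipschitz i) _
  calc ∫⁻ z in Q, ‖φ z‖ₑ ^ 2 = ∫⁻ t, ∫⁻ y in timeSlice Q t, ‖φ (y, t)‖ₑ ^ 2 :=
        setLIntegral_eq_lintegral_timeSlice hQm hψ
    _ ≤ ∫⁻ t, (2 * (C * D t) + 2 * (C ^ 2 * ∫⁻ y in timeSlice Q t, ‖q (y, t)‖ₑ ^ 2)) := by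
        refine lintegral_mono_ae ?_
        filter_upwards [h.ae_notMem] with t ht
        obtain ⟨s, hs, hle⟩ := (h.separated t ht).exists_lintegral_enorm_sq_le (hC t)
          (continuousOn_timeSlice hc t) (hq.comp (by fun_prop : Measurable fun x : ℝ => (x, t)))
          fun y hy => hd (y, t) hy
        refine hle.trans ?_
        have := sum_frontier_le_sum_indicator h.mem_graph (fun z => ‖φ z‖ₑ ^ 2) s
          (t := t) fun x hx => mem_lateral_iff.2 (hs x hx)
        gcongr
        exact le_rfl
    _ = 2 * (C * ∫⁻ t, D t) + 2 * (C ^ 2 * ∫⁻ z in Q, ‖q z‖ₑ ^ 2) := by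
        rw [lintegral_add_left ((hDm.const_mul _).const_mul _), lintegral_const_mul' _ _ (by simp),
          lintegral_const_mul' _ _ hCt, lintegral_const_mul' _ _ (by simp),
          lintegral_const_mul' _ _ (by simpa using hCt),
          setLIntegral_eq_lintegral_timeSlice hQm (hq.enorm.pow_const 2)]
    _ ≤ _ := by gcongr

end HasLateralCurves

/-! ### Primitives and integral operators in the space variable -/

lemma hasDerivAt_fderiv_dx {φ : ℝ × ℝ → ℝ} {z : ℝ × ℝ} (h : DifferentiableAt ℝ φ z) :
    HasDerivAt (fun x => φ (x, z.2)) (fderiv ℝ φ z (1, 0)) z.1 :=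
  HasFDerivAt.comp_hasDerivAt z.1 (l := φ) (f := fun x => (x, z.2)) h.hasFDerivAt
    ((hasDerivAt_id z.1).prodMk (hasDerivAt_const z.1 z.2))

lemma fderiv_dx_eq {φ : ℝ × ℝ → ℝ} {z : ℝ × ℝ} (h : DifferentiableAt ℝ φ z) {φ' : ℝ}
    (hd : HasDerivAt (fun x => φ (x, z.2)) φ' z.1) : fderiv ℝ φ z (1, 0) = φ' :=
  (hasDerivAt_fderiv_dx h).unique hd

lemma ae_ae_slice {p : ℝ × ℝ → Prop} (h : ∀ᵐ z, p z) : ∀ᵐ t : ℝ, ∀ᵐ x : ℝ, p (x, t) :=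
  Measure.ae_ae_of_ae_prod (p := fun w : ℝ × ℝ => p w.swap)
    ((Measure.measurePreserving_swap (μ := (volume : Measure ℝ))
      (ν := (volume : Measure ℝ))).quasiMeasurePreserving.ae h)

lemma hasCompactSupport_slice {θ : ℝ × ℝ → ℝ} (hc : HasCompactSupport θ) (t : ℝ) :
    HasCompactSupport fun x => θ (x, t) := by
  refine HasCompactSupport.intro (K := Prod.fst '' tsupport θ) (hc.isCompact.image continuous_fst)
    fun x hx => ?_
  exact image_eq_zero_of_notMem_tsupport fun h => hx ⟨(x, t), h, rfl⟩

lemma integrable_slice {θ : ℝ × ℝ → ℝ} (hθ : Continuous θ) (hc : HasCompactSupport θ) (t : ℝ) :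
    Integrable fun x => θ (x, t) :=
  (by fun_prop : Continuous fun x => θ (x, t)).integrable_of_hasCompactSupport
    (hasCompactSupport_slice hc t)

/-- The primitive in the space variable of a test function is smooth. -/
lemma contDiff_integral_Iic {θ : ℝ × ℝ → ℝ} (hθ : ContDiff ℝ ∞ θ) (hc : HasCompactSupport θ) :
    ContDiff ℝ ∞ fun z : ℝ × ℝ => ∫ y in Iic z.1, θ (y, z.2) := by
  -- The primitive is the convolution in `x` of `θ (·, t)` with the Heaviside function, `t` being a
  -- parameter.
  set H : ℝ → ℝ := (Ici 0).indicator fun _ => 1 with hH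
  have hHl : LocallyIntegrable H volume :=
    (locallyIntegrable_const (1 : ℝ)).indicator measurableSet_Ici
  have h1 := contDiffOn_convolution_right_with_param (𝕜 := ℝ) (n := (⊤ : ℕ∞)) (μ := volume)
    (ContinuousLinearMap.mul ℝ ℝ) (f := H) (g := fun t x => θ (x, t)) (s := univ)
    (k := Prod.fst '' tsupport θ) isOpen_univ (hc.isCompact.image continuous_fst)
    (fun t x _ hx => image_eq_zero_of_notMem_tsupport fun h => hx ⟨(x, t), h, rfl⟩) hHl
    (hθ.comp (contDiff_snd.prodMk contDiff_fst)).contDiffOn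
  rw [univ_prod_univ, contDiffOn_univ] at h1
  have h2 := h1.comp (contDiff_snd.prodMk contDiff_fst : ContDiff ℝ ∞ fun z : ℝ × ℝ => (z.2, z.1))
  refine (congrArg (ContDiff ℝ ∞) (funext fun z => ?_)).mp h2
  change ∫ s, H s * θ (z.1 - s, z.2) = _
  rw [← integral_sub_left_eq_self _ volume z.1, ← integral_indicator measurableSet_Iic]
  refine integral_congr_ae (ae_of_all _ fun y => ?_)
  by_cases hy : y ≤ z.1
  · simp [hH, hy]
  · simp [hH, hy]

lemma hasDerivAt_integral_Iic {θ : ℝ → ℝ} (hθ : Continuous θ) (hi : Integrable θ) (x : ℝ) :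
    HasDerivAt (fun x => ∫ y in Iic x, θ y) (θ x) x := by
  have h1 : (fun x => ∫ y in Iic x, θ y) =
      fun x => (∫ y in Iic (0 : ℝ), θ y) + ∫ y in (0 : ℝ)..x, θ y := by
    funext x
    rw [← intervalIntegral.integral_Iic_sub_Iic hi.integrableOn hi.integrableOn,
      add_sub_cancel]
  rw [h1]
  exact (hθ.integral_hasStrictDerivAt 0 x).hasDerivAt.const_add _

lemma integral_Ici_eq {f : ℝ → ℝ} (hf : Integrable f) (a x : ℝ) :
    ∫ y in Ici x, f y = (∫ y in Ici a, f y) - ∫ y in a..x, f y := by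
  rw [integral_Ici_eq_integral_Ioi, integral_Ici_eq_integral_Ioi,
    ← intervalIntegral.integral_Ioi_sub_Ioi' hf.integrableOn hf.integrableOn]
  ring

lemma continuous_integral_Ici {f : ℝ → ℝ} (hf : Integrable f) :
    Continuous fun x => ∫ y in Ici x, f y := by
  have h1 : (fun x => ∫ y in Ici x, f y) =
      fun x => (∫ y in Ici (0 : ℝ), f y) - ∫ y in (0 : ℝ)..x, f y :=
    funext fun x => integral_Ici_eq hf 0 x
  rw [h1]
  exact continuous_const.sub
    (intervalIntegral.continuous_primitive (fun _ _ => hf.intervalIntegrable) 0)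

section Kernel

variable {k : ℝ → ℝ → ℝ} {B : ℝ} {f θ : ℝ × ℝ → ℝ}

lemma stronglyMeasurable_kernel (hk : Measurable (Function.uncurry k))
    (hfm : StronglyMeasurable f) :
    StronglyMeasurable fun z : ℝ × ℝ => ∫ x, k x z.1 * f (x, z.2) := by
  refine StronglyMeasurable.integral_prod_right (f := fun (z : ℝ × ℝ) x => k x z.1 * f (x, z.2)) ?_
  have h1 : Measurable fun w : (ℝ × ℝ) × ℝ => Function.uncurry k (w.2, w.1.1) :=
    hk.comp (by fun_prop)
  have h2 : Measurable fun w : (ℝ × ℝ) × ℝ => f (w.2, w.1.2) :=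
    hfm.measurable.comp (by fun_prop)
  exact (h1.mul h2).stronglyMeasurable

/-- The transform is bounded by `B ∫ |f(x, t)| dx`, which does not depend on the space variable and
is integrable in `t`. -/
lemma locallyIntegrable_kernel (hk : Measurable (Function.uncurry k)) (hB : ∀ x y, |k x y| ≤ B)
    (hfm : StronglyMeasurable f) (hf : Integrable f) :
    LocallyIntegrable fun z : ℝ × ℝ => ∫ x, k x z.1 * f (x, z.2) := by
  set m : ℝ → ℝ := fun t => ∫ x, ‖f (x, t)‖ with hm
  have hmi : Integrable m := Integrable.integral_prod_right (μ := (volume : Measure ℝ))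
    (ν := (volume : Measure ℝ)) hf.norm
  have hfa : ∀ᵐ t : ℝ, Integrable fun x => f (x, t) := Integrable.prod_left_ae
    (μ := (volume : Measure ℝ)) (ν := (volume : Measure ℝ)) hf
  have hbd : ∀ᵐ z : ℝ × ℝ, ‖∫ x, k x z.1 * f (x, z.2)‖ ≤ B * m z.2 := by
    filter_upwards [(Measure.quasiMeasurePreserving_snd (μ := (volume : Measure ℝ))
      (ν := (volume : Measure ℝ))).ae hfa] with z hz
    refine (norm_integral_le_integral_norm _).trans ?_
    rw [hm, ← integral_const_mul]
    refine integral_mono_of_nonneg (ae_of_all _ fun x => norm_nonneg _) (hz.norm.const_mul B)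
      (ae_of_all _ fun x => ?_)
    simp only [norm_mul]
    exact mul_le_mul_of_nonneg_right (hB x z.1) (norm_nonneg _)
  rw [locallyIntegrable_iff]
  intro C hC
  obtain ⟨R, hR⟩ := hC.isBounded.subset_closedBall 0
  have hsub : C ⊆ Icc (-R) R ×ˢ univ := fun z hz => by
    have h1 := (norm_fst_le z).trans (mem_closedBall_zero_iff.1 (hR hz))
    rw [Real.norm_eq_abs, abs_le] at h1
    exact ⟨h1, mem_univ _⟩
  refine IntegrableOn.mono_set ?_ hsub
  have h2 : Integrable (fun z : ℝ × ℝ => B * m z.2)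
      ((volume.restrict (Icc (-R) R)).prod (volume : Measure ℝ)) :=
    (hmi.const_mul B).comp_snd _
  have h3 : (volume : Measure (ℝ × ℝ)).restrict (Icc (-R) R ×ˢ univ) =
      (volume.restrict (Icc (-R) R)).prod (volume : Measure ℝ) := by
    rw [Measure.volume_eq_prod, ← Measure.prod_restrict, Measure.restrict_univ]
  rw [← h3] at h2
  exact Integrable.mono' h2 (stronglyMeasurable_kernel hk hfm).aestronglyMeasurable
    (ae_restrict_of_ae hbd)

/-- Fubini's theorem for an integral operator acting in the space variable. -/
lemma integral_mul_kernel (hk : Measurable (Function.uncurry k)) (hB : ∀ x y, |k x y| ≤ B)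
    (hfm : StronglyMeasurable f) (hf : Integrable f) (hθ : Continuous θ)
    (hc : HasCompactSupport θ) :
    ∫ z, f z * ∫ y, k z.1 y * θ (y, z.2) = ∫ z, θ z * ∫ x, k x z.1 * f (x, z.2) := by
  have hk' : Measurable (Function.uncurry fun y x => k x y) := hk.comp measurable_swap
  obtain ⟨D, hD⟩ : ∃ D, ∀ t, ∫ y, ‖θ (y, t)‖ ≤ D := by
    obtain ⟨M, hM⟩ := hc.exists_bound_of_continuous hθ
    obtain ⟨R, hR⟩ := hc.isCompact.isBounded.subset_closedBall 0
    have hM0 : 0 ≤ M := (norm_nonneg _).trans (hM 0)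
    refine ⟨∫ y : ℝ, (Icc (-R) R).indicator (fun _ => M) y, fun t => ?_⟩
    refine integral_mono_of_nonneg (ae_of_all _ fun y => norm_nonneg _)
      ((integrable_indicator_iff measurableSet_Icc).2 (by simp [IntegrableOn])) ?_
    refine ae_of_all _ fun y => ?_
    by_cases hy : y ∈ Icc (-R) R
    · simpa [indicator_of_mem hy] using hM (y, t)
    · have h0 : θ (y, t) = 0 := image_eq_zero_of_notMem_tsupport fun h => hy <| by
        have h1 := (norm_fst_le _).trans (mem_closedBall_zero_iff.1 (hR h))
        rwa [Real.norm_eq_abs, abs_le] at h1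
      simp [h0, indicator_of_notMem hy]
  have hB0 : 0 ≤ B := (abs_nonneg _).trans (hB 0 0)
  have hL : Integrable fun z => f z * ∫ y, k z.1 y * θ (y, z.2) := by
    refine hf.mul_bdd (c := B * D)
      (stronglyMeasurable_kernel hk' hθ.stronglyMeasurable).aestronglyMeasurable
      (ae_of_all _ fun z => ?_)
    refine (norm_integral_le_integral_norm _).trans
      (le_trans ?_ (mul_le_mul_of_nonneg_left (hD z.2) hB0))
    rw [← integral_const_mul]
    refine integral_mono_of_nonneg (ae_of_all _ fun y => norm_nonneg _)
      ((integrable_slice hθ hc z.2).norm.const_mul B) (ae_of_all _ fun y => ?_)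
    simp only [norm_mul]
    exact mul_le_mul_of_nonneg_right (hB z.1 y) (norm_nonneg _)
  have hR : Integrable fun z => θ z * ∫ x, k x z.1 * f (x, z.2) :=
    (locallyIntegrable_kernel hk hB hfm hf).integrable_smul_left_of_hasCompactSupport hθ hc
  have hfa : ∀ᵐ t : ℝ, Integrable fun x => f (x, t) := Integrable.prod_left_ae
    (μ := (volume : Measure ℝ)) (ν := (volume : Measure ℝ)) hf
  rw [Measure.volume_eq_prod, integral_prod_symm _ hL, integral_prod_symm _ hR]
  refine integral_congr_ae ?_
  filter_upwards [hfa] with t ht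
  have hsw : Integrable (Function.uncurry fun x y => f (x, t) * (k x y * θ (y, t)))
      ((volume : Measure ℝ).prod volume) := by
    have h1 := (ht.mul_prod (integrable_slice hθ hc t)).bdd_mul (c := B)
      hk.aestronglyMeasurable (ae_of_all _ fun p => hB p.1 p.2)
    refine h1.congr (ae_of_all _ fun p => ?_)
    simp only [Function.uncurry]
    ring
  calc ∫ x, f (x, t) * ∫ y, k x y * θ (y, t)
      = ∫ x, ∫ y, f (x, t) * (k x y * θ (y, t)) := by simp_rw [integral_const_mul]
    _ = ∫ y, ∫ x, f (x, t) * (k x y * θ (y, t)) := integral_integral_swap hsw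
    _ = ∫ y, θ (y, t) * ∫ x, k x y * f (x, t) := by
        refine integral_congr_ae (ae_of_all _ fun y => ?_)
        beta_reduce
        rw [← integral_const_mul]
        refine integral_congr_ae (ae_of_all _ fun x => ?_)
        ring

end Kernel

lemma measurable_indicator_Iic :
    Measurable (Function.uncurry fun x y : ℝ => (Iic x).indicator (fun _ => (1 : ℝ)) y) :=
  (measurable_const (a := (1 : ℝ))).indicator
    (measurableSet_le measurable_snd measurable_fst : MeasurableSet {p : ℝ × ℝ | p.2 ≤ p.1})

lemma abs_indicator_Iic_le (x y : ℝ) : |(Iic x).indicator (fun _ => (1 : ℝ)) y| ≤ 1 := by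
  by_cases h : y ≤ x
  · simp [indicator, h]
  · simp [indicator, h]

lemma integral_indicator_Iic_mul (x : ℝ) (θ : ℝ → ℝ) :
    ∫ y, (Iic x).indicator (fun _ => (1 : ℝ)) y * θ y = ∫ y in Iic x, θ y := by
  rw [← integral_indicator measurableSet_Iic]
  refine integral_congr_ae (ae_of_all _ fun y => ?_)
  by_cases h : y ≤ x
  · simp [indicator, h]
  · simp [indicator, h]

lemma integral_indicator_Iic_mul' (y : ℝ) (f : ℝ → ℝ) :
    ∫ x, (Iic x).indicator (fun _ => (1 : ℝ)) y * f x = ∫ x in Ici y, f x := by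
  rw [← integral_indicator measurableSet_Ici]
  refine integral_congr_ae (ae_of_all _ fun x => ?_)
  by_cases h : y ≤ x
  · simp [indicator, h]
  · simp [indicator, h]

/-! ### Weak derivatives and annihilators as primitives on slices -/

/-- If `(f, h)` annihilates all `(φ, ∂ₓ φ)` then `h` is a primitive of `f` on every time slice. -/
lemma ae_eq_neg_integral_Ici {f h : ℝ × ℝ → ℝ} (hfm : StronglyMeasurable f) (hf : Integrable f)
    (hh : Integrable h)
    (H : ∀ φ : ℝ × ℝ → ℝ, ContDiff ℝ ∞ φ →
      (∫ z, f z * φ z) + ∫ z, h z * fderiv ℝ φ z (1, 0) = 0) :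
    ∀ᵐ z : ℝ × ℝ, h z = -∫ x in Ici z.1, f (x, z.2) := by
  have hloc := locallyIntegrable_kernel measurable_indicator_Iic abs_indicator_Iic_le hfm hf
  simp only [integral_indicator_Iic_mul'] at hloc
  have key : ∀ᵐ z : ℝ × ℝ, h z + ∫ x in Ici z.1, f (x, z.2) = 0 := by
    refine ae_eq_zero_of_integral_contDiff_smul_eq_zero (hh.locallyIntegrable.add hloc) ?_
    intro θ hθ hc
    -- The test function is the space primitive of `θ`. It need not have compact support, so `H` is
    -- required for all smooth `φ`.
    have h1 := H _ (contDiff_integral_Iic hθ hc)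
    have h2 := integral_mul_kernel measurable_indicator_Iic abs_indicator_Iic_le hfm hf
      hθ.continuous hc
    simp only [integral_indicator_Iic_mul, integral_indicator_Iic_mul'] at h2
    rw [h2] at h1
    have h3 : ∀ z, fderiv ℝ (fun z : ℝ × ℝ => ∫ y in Iic z.1, θ (y, z.2)) z (1, 0) = θ z :=
      fun z => fderiv_dx_eq (((contDiff_integral_Iic hθ hc).differentiable (by simp)) z)
        (hasDerivAt_integral_Iic (hθ.continuous.comp (by fun_prop))
          (integrable_slice hθ.continuous hc z.2) z.1)
    simp only [h3] at h1
    simp only [smul_eq_mul, mul_add]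
    rw [integral_add ?_ ?_, add_comm, ← h1]
    · congr 1
      simp only [mul_comm]
    · exact hh.locallyIntegrable.integrable_smul_left_of_hasCompactSupport hθ.continuous hc
    · exact hloc.integrable_smul_left_of_hasCompactSupport hθ.continuous hc
  filter_upwards [key] with z hz
  linarith

/-- A smooth step function. -/
lemma exists_smooth_step {c d : ℝ} (h : c < d) : ∃ Ψ : ℝ → ℝ, ContDiff ℝ ∞ Ψ ∧
    (∀ x, |Ψ x| ≤ 1) ∧ (∀ x ≤ c, Ψ x = 0) ∧ (∀ x, d ≤ x → Ψ x = 1) ∧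
    ∃ B, ∀ x, |deriv Ψ x| ≤ B := by
  have hcd : 0 < d - c := sub_pos.2 h
  set Ψ : ℝ → ℝ := fun x => Real.smoothTransition ((x - c) / (d - c)) with hΨ
  have hs : ContDiff ℝ ∞ Ψ := Real.smoothTransition.contDiff.comp (by fun_prop)
  have h0 : ∀ x ≤ c, Ψ x = 0 := fun x hx =>
    Real.smoothTransition.zero_of_nonpos (div_nonpos_of_nonpos_of_nonneg (by linarith) hcd.le)
  have h1 : ∀ x, d ≤ x → Ψ x = 1 := fun x hx =>
    Real.smoothTransition.one_of_one_le ((one_le_div hcd).2 (by linarith))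
  refine ⟨Ψ, hs, fun x => abs_le.2 ⟨by linarith [Real.smoothTransition.nonneg ((x - c) / (d - c))],
    Real.smoothTransition.le_one _⟩, h0, h1, ?_⟩
  have hcs : HasCompactSupport (deriv Ψ) := by
    refine HasCompactSupport.intro (isCompact_Icc (a := c) (b := d)) fun x hx => ?_
    rw [mem_Icc, not_and_or, not_le, not_le] at hx
    rcases hx with hx | hx
    · have : Ψ =ᶠ[𝓝 x] fun _ => 0 := (eventually_lt_nhds hx).mono fun y hy => h0 y hy.le
      rw [this.deriv_eq, deriv_const]
    · have : Ψ =ᶠ[𝓝 x] fun _ => 1 := (eventually_gt_nhds hx).mono fun y hy => h1 y hy.le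
      rw [this.deriv_eq, deriv_const]
  exact hcs.exists_bound_of_continuous (hs.continuous_deriv (by simp))

lemma exists_Icc_of_isCompact_subset_Ioo {K : Set ℝ} (hK : IsCompact K) (hne : K.Nonempty)
    {c d : ℝ} (h : K ⊆ Ioo c d) : ∃ c' d', c < c' ∧ d' < d ∧ K ⊆ Icc c' d' :=
  ⟨sInf K, sSup K, (h (hK.sInf_mem hne)).1, (h (hK.sSup_mem hne)).2,
    fun _ hx => ⟨csInf_le hK.bddBelow hx, le_csSup hK.bddAbove hx⟩⟩

/-- On a rectangle a function with integrable weak space derivative `g` is, on almost every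
horizontal segment, a primitive of `g`. -/
lemma exists_ae_eq_sub_integral_Ici {u g : ℝ × ℝ → ℝ} (hum : StronglyMeasurable u)
    (hu : Integrable u) (hgm : StronglyMeasurable g) (hg : Integrable g) {c d s r : ℝ}
    (hcd : c < d)
    (H : ∀ φ : ℝ × ℝ → ℝ, ContDiff ℝ ∞ φ → HasCompactSupport φ →
      tsupport φ ⊆ Ioo c d ×ˢ Ioo s r →
      ∫ z, u z * fderiv ℝ φ z (1, 0) = -∫ z, g z * φ z) :
    ∃ m : ℝ → ℝ, ∀ᵐ z : ℝ × ℝ, z ∈ Ioo c d ×ˢ Ioo s r →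
      u z = m z.2 - ∫ x in Ici z.1, g (x, z.2) := by
  obtain ⟨c₁, hc₁, hc₁d⟩ := exists_between hcd
  obtain ⟨d₁, hcd₁, hd₁⟩ := exists_between hc₁d
  obtain ⟨Ψ, hΨ, hΨ1, hΨ0, hΨd, B, hB⟩ := exists_smooth_step hcd₁
  have hψc : Continuous (deriv Ψ) := hΨ.continuous_deriv (by simp)
  -- The plain primitive of `θ` does not return to zero at the right end. Subtracting `Ψ` times the
  -- total mass of `θ (·, t)` restores compact support in the rectangle; `kA` is the kernel of this
  -- corrected primitive.
  set kA : ℝ → ℝ → ℝ := fun x y => (Iic x).indicator (fun _ => (1 : ℝ)) y - Ψ x with hkA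
  have hkAm : Measurable (Function.uncurry kA) :=
    measurable_indicator_Iic.sub (hΨ.continuous.measurable.comp measurable_fst)
  have hkAb : ∀ x y, |kA x y| ≤ 2 := fun x y =>
    (abs_sub _ _).trans (by linarith [abs_indicator_Iic_le x y, hΨ1 x])
  have hkBm : Measurable (Function.uncurry fun x _ : ℝ => deriv Ψ x) :=
    hψc.measurable.comp measurable_fst
  have hlA := locallyIntegrable_kernel hkAm hkAb hgm hg
  have hlB := locallyIntegrable_kernel hkBm (fun x _ => hB x) hum hu
  have key : ∀ᵐ z : ℝ × ℝ, z ∈ Ioo c d ×ˢ Ioo s r →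
      u z - (∫ x, deriv Ψ x * u (x, z.2)) + ∫ x, kA x z.1 * g (x, z.2) = 0 := by
    refine (isOpen_Ioo.prod isOpen_Ioo).ae_eq_zero_of_integral_contDiff_smul_eq_zero
      (((hu.locallyIntegrable.sub hlB).add hlA).locallyIntegrableOn _) ?_
    intro θ hθ hc hsupp
    have hθc := hθ.continuous
    set P : ℝ × ℝ → ℝ := fun z => ∫ y in Iic z.1, θ (y, z.2) with hP
    have hPs : ContDiff ℝ ∞ P := contDiff_integral_Iic hθ hc
    have hzero : ∀ x t, x ∉ Ioo c d → θ (x, t) = 0 := fun x t hx =>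
      image_eq_zero_of_notMem_tsupport fun h => hx (hsupp h).1
    have hPd : ∀ t, P (d, t) = ∫ y, θ (y, t) := fun t =>
      setIntegral_eq_integral_of_forall_compl_eq_zero fun x hx => hzero x t fun h => hx h.2.le
    set φ : ℝ × ℝ → ℝ := fun z => P z - Ψ z.1 * P (d, z.2) with hφ
    have hφs : ContDiff ℝ ∞ φ := hPs.sub ((hΨ.comp contDiff_fst).mul
      (hPs.comp (contDiff_const.prodMk contDiff_snd)))
    have hφd : ∀ z, fderiv ℝ φ z (1, 0) = θ z - deriv Ψ z.1 * P (d, z.2) := fun z => by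
      refine fderiv_dx_eq (hφs.differentiable (by simp) z) ?_
      refine (hasDerivAt_integral_Iic (θ := fun x => θ (x, z.2)) (by fun_prop)
        (integrable_slice hθc hc z.2) z.1).sub ?_
      exact ((hΨ.differentiable (by simp)) z.1).hasDerivAt.mul_const (P (d, z.2))
    have hφk : ∀ z, φ z = ∫ y, kA z.1 y * θ (y, z.2) := fun z => by
      have hi := integrable_slice hθc hc z.2
      have hi' : Integrable fun y => (Iic z.1).indicator (fun _ => (1 : ℝ)) y * θ (y, z.2) :=
        hi.bdd_mul (c := 1) (aestronglyMeasurable_const.indicator measurableSet_Iic)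
          (ae_of_all _ fun y => abs_indicator_Iic_le _ _)
      simp only [hkA, sub_mul]
      rw [integral_sub hi' (hi.const_mul _), integral_indicator_Iic_mul, integral_const_mul,
        ← hPd]
    -- Adding `c₁` and `d₁` makes `[a', b']` contain the transition zone of `Ψ`, and keeps the
    -- compact set nonempty when `θ = 0`.
    obtain ⟨a', b', ha', hb', hab⟩ := exists_Icc_of_isCompact_subset_Ioo
      (K := Prod.fst '' tsupport θ ∪ {c₁, d₁})
      ((hc.isCompact.image continuous_fst).union (toFinite _).isCompact) ⟨c₁, by simp⟩ (by
        rintro x (⟨z, hz, rfl⟩ | hx)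
        · exact (hsupp hz).1
        · rcases hx with rfl | hx
          · exact ⟨hc₁, hc₁d⟩
          · rw [mem_singleton_iff.1 hx]
            exact ⟨hc₁.trans hcd₁, hd₁⟩)
    have hac : a' ≤ c₁ := (hab (Or.inr (by simp))).1
    have hdb : d₁ ≤ b' := (hab (Or.inr (by simp))).2
    have hzero' : ∀ x t, x ∉ Icc a' b' → θ (x, t) = 0 := fun x t hx =>
      image_eq_zero_of_notMem_tsupport fun h => hx (hab (Or.inl ⟨_, h, rfl⟩))
    set L : Set (ℝ × ℝ) := Icc a' b' ×ˢ (Prod.snd '' tsupport θ) with hL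
    have hLc : IsCompact L := isCompact_Icc.prod (hc.isCompact.image continuous_snd)
    have hφL : ∀ z ∉ L, φ z = 0 := by
      intro z hz
      by_cases ht : z.2 ∈ Prod.snd '' tsupport θ
      · have hx : z.1 ∉ Icc a' b' := fun h => hz ⟨h, ht⟩
        rw [mem_Icc, not_and_or, not_le, not_le] at hx
        rcases hx with hx | hx
        · have h1 : P z = 0 := setIntegral_eq_zero_of_forall_eq_zero fun y hy =>
            hzero' y _ fun h => absurd (h.1.trans hy) (not_le.2 hx)
          simp only [hφ]
          rw [h1, hΨ0 z.1 (hx.le.trans hac), zero_mul, sub_zero]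
        · have h1 : P z = ∫ y, θ (y, z.2) :=
            setIntegral_eq_integral_of_forall_compl_eq_zero fun y hy =>
              hzero' y _ fun h => hy (h.2.trans hx.le)
          simp only [hφ]
          rw [h1, hΨd z.1 (hdb.trans hx.le), hPd, one_mul, sub_self]
      · have h0 : ∀ y, θ (y, z.2) = 0 := fun y =>
          image_eq_zero_of_notMem_tsupport fun h => ht ⟨_, h, rfl⟩
        simp [hφ, hP, h0]
    have hts : tsupport φ ⊆ L := closure_minimal
      (fun z hz => by_contra fun h => hz (hφL z h)) hLc.isClosed
    have h1 := H φ hφs (HasCompactSupport.intro hLc hφL) (hts.trans fun z hz => ⟨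
      ⟨ha'.trans_le hz.1.1, hz.1.2.trans_lt hb'⟩, by
        obtain ⟨w, hw, he⟩ := hz.2
        rw [← he]
        exact (hsupp hw).2⟩)
    have hA := integral_mul_kernel hkAm hkAb hgm hg hθc hc
    have hBk := integral_mul_kernel hkBm (fun x _ => hB x) hum hu hθc hc
    simp only [← hφk] at hA
    have hBe : ∀ z : ℝ × ℝ, ∫ y, deriv Ψ z.1 * θ (y, z.2) = deriv Ψ z.1 * P (d, z.2) :=
      fun z => by rw [integral_const_mul, hPd]
    simp only [hBe] at hBk
    have hiu : Integrable fun z => θ z * u z :=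
      hu.locallyIntegrable.integrable_smul_left_of_hasCompactSupport hθc hc
    have hiB : Integrable fun z => θ z * ∫ x, deriv Ψ x * u (x, z.2) :=
      hlB.integrable_smul_left_of_hasCompactSupport hθc hc
    have hiA : Integrable fun z => θ z * ∫ x, kA x z.1 * g (x, z.2) :=
      hlA.integrable_smul_left_of_hasCompactSupport hθc hc
    have hdcs : HasCompactSupport fun z => fderiv ℝ φ z (1, 0) :=
      (HasCompactSupport.intro hLc hφL).fderiv_apply ℝ _
    have hdi : Integrable fun z => fderiv ℝ φ z (1, 0) * u z :=
      hu.locallyIntegrable.integrable_smul_left_of_hasCompactSupport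
        (continuous_dx_test hφs) hdcs
    have hsplit : ∫ z, u z * fderiv ℝ φ z (1, 0) =
        (∫ z, θ z * u z) - ∫ z, u z * (deriv Ψ z.1 * P (d, z.2)) := by
      rw [← integral_sub hiu]
      · refine integral_congr_ae (ae_of_all _ fun z => ?_)
        beta_reduce
        rw [hφd]
        ring
      · refine (hiu.sub hdi).congr (ae_of_all _ fun z => ?_)
        simp only [Pi.sub_apply, hφd]
        ring
    rw [hsplit, hBk, hA] at h1
    simp only [smul_eq_mul, mul_add, mul_sub]
    have hi : Integrable fun z => θ z * u z - θ z * ∫ x, deriv Ψ x * u (x, z.2) := hiu.sub hiB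
    rw [integral_add hi hiA, integral_sub hiu hiB]
    linarith
  have hga : ∀ᵐ t : ℝ, Integrable fun x => g (x, t) := Integrable.prod_left_ae
    (μ := (volume : Measure ℝ)) (ν := (volume : Measure ℝ)) hg
  -- These are the terms of `key` that are independent of `x`; what is left of the `kA` term is the
  -- integral of `g` over `Ici z.1`.
  refine ⟨fun t => (∫ x, deriv Ψ x * u (x, t)) + ∫ x, Ψ x * g (x, t), ?_⟩
  filter_upwards [key, (Measure.quasiMeasurePreserving_snd (μ := (volume : Measure ℝ))
    (ν := (volume : Measure ℝ))).ae hga] with z hz hgz hzR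
  have h1 := hz hzR
  have h2 : ∫ x, kA x z.1 * g (x, z.2) =
      (∫ x in Ici z.1, g (x, z.2)) - ∫ x, Ψ x * g (x, z.2) := by
    have hi' : Integrable fun x => (Iic x).indicator (fun _ => (1 : ℝ)) z.1 * g (x, z.2) :=
      hgz.bdd_mul (c := 1)
        (measurable_indicator_Iic.comp (by fun_prop : Measurable fun x : ℝ =>
          (x, z.1))).aestronglyMeasurable (ae_of_all _ fun y => abs_indicator_Iic_le _ _)
    simp only [hkA, sub_mul]
    rw [integral_sub hi' (hgz.bdd_mul (c := 1) hΨ.continuous.aestronglyMeasurable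
      (ae_of_all _ hΨ1)), integral_indicator_Iic_mul']
  rw [h2] at h1
  linarith

/-- On almost every time slice, a function with integrable weak space derivative `g` is a primitive
of `g` on every interval of the slice. -/
lemma ae_forall_exists_ae_eq_sub_integral_Ici {Q : Set (ℝ × ℝ)} (hQ : IsOpen Q)
    {u g : ℝ × ℝ → ℝ} (hum : StronglyMeasurable u)
    (hu : Integrable u) (hgm : StronglyMeasurable g) (hg : Integrable g)
    (H : ∀ φ : ℝ × ℝ → ℝ, ContDiff ℝ ∞ φ → HasCompactSupport φ → tsupport φ ⊆ Q →
      ∫ z, u z * fderiv ℝ φ z (1, 0) = -∫ z, g z * φ z) :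
    ∀ᵐ t : ℝ, ∀ a b, a < b → Ioo a b ⊆ timeSlice Q t →
      ∃ m, ∀ᵐ x : ℝ, x ∈ Ioo a b → u (x, t) = m - ∫ y in Ici x, g (y, t) := by
  -- Countably many rational rectangles allow one null set of times to serve all intervals `(a, b)`,
  -- of which there are uncountably many.
  have hrat : ∀ᵐ t : ℝ, ∀ c d s r : ℚ, (c : ℝ) < d → Ioo (c : ℝ) d ×ˢ Ioo (s : ℝ) r ⊆ Q →
      t ∈ Ioo (s : ℝ) r →
      ∃ m, ∀ᵐ x : ℝ, x ∈ Ioo (c : ℝ) d → u (x, t) = m - ∫ y in Ici x, g (y, t) := by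
    simp only [ae_all_iff]
    intro c d s r hcd hsub
    obtain ⟨m, hm⟩ := exists_ae_eq_sub_integral_Ici hum hu hgm hg hcd
      (s := (s : ℝ)) (r := (r : ℝ)) fun φ h1 h2 h3 => H φ h1 h2 (h3.trans hsub)
    filter_upwards [ae_ae_slice hm] with t ht htI
    exact ⟨m t, ht.mono fun x hx hxI => hx ⟨hxI, htI⟩⟩
  filter_upwards [hrat] with t ht a b hab hsub
  have hcpt : ∀ p q : ℚ, a < p → (p : ℝ) < q → (q : ℝ) < b →
      ∃ m, ∀ᵐ x : ℝ, x ∈ Ioo (p : ℝ) q → u (x, t) = m - ∫ y in Ici x, g (y, t) := by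
    intro p q hp hpq hq
    obtain ⟨U, V, hU, hV, hpU, htV, hUV⟩ := generalized_tube_lemma (isCompact_Icc (a := (p : ℝ))
      (b := q)) (isCompact_singleton (x := t)) hQ (by
        rintro ⟨x, t'⟩ ⟨hx, ht'⟩
        obtain rfl : t' = t := ht'
        exact hsub ⟨hp.trans_le hx.1, hx.2.trans_lt hq⟩)
    obtain ⟨l, w, htlw, hlw⟩ := mem_nhds_iff_exists_Ioo_subset.1
      (hV.mem_nhds (htV (mem_singleton t)))
    obtain ⟨s, hs1, hs2⟩ := exists_rat_btwn htlw.1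
    obtain ⟨r, hr1, hr2⟩ := exists_rat_btwn htlw.2
    refine ht p q s r hpq (fun z hz => hUV ⟨hpU (Ioo_subset_Icc_self hz.1),
      hlw ⟨hs1.trans hz.2.1, hz.2.2.trans hr2⟩⟩) ⟨hs2, hr1⟩
  -- A fixed rational subinterval determines the constant. Every larger rational subinterval has the
  -- same one, since the two identities hold together on a set of positive measure.
  obtain ⟨p₀, hp₀, hp₀b⟩ := exists_rat_btwn hab
  obtain ⟨q₀, hpq₀, hq₀⟩ := exists_rat_btwn hp₀b
  obtain ⟨m₀, hm₀⟩ := hcpt p₀ q₀ hp₀ hpq₀ hq₀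
  refine ⟨m₀, ?_⟩
  have hall : ∀ᵐ x : ℝ, ∀ p q : ℚ, a < p → (p : ℝ) < p₀ → (q₀ : ℝ) < q → (q : ℝ) < b →
      x ∈ Ioo (p : ℝ) q → u (x, t) = m₀ - ∫ y in Ici x, g (y, t) := by
    simp only [ae_all_iff]
    intro p q h1 h2 h3 h4
    obtain ⟨m, hm⟩ := hcpt p q h1 (h2.trans (hpq₀.trans h3)) h4
    have hmm : m = m₀ := by
      by_contra hne
      have hnull : ∀ᵐ x : ℝ, x ∉ Ioo (p₀ : ℝ) q₀ := by
        filter_upwards [hm, hm₀] with x hx hx₀ hxI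
        have e1 := hx ⟨h2.trans hxI.1, hxI.2.trans h3⟩
        have e2 := hx₀ hxI
        exact hne (by linarith)
      rw [ae_iff] at hnull
      simp only [not_not, Set.ofPred_mem_eq, Real.volume_Ioo, ENNReal.ofReal_eq_zero] at hnull
      linarith
    rwa [hmm] at hm
  filter_upwards [hall] with x hx hxI
  obtain ⟨p, hp1, hp2⟩ := exists_rat_btwn (lt_min hxI.1 hp₀)
  obtain ⟨q, hq1, hq2⟩ := exists_rat_btwn (max_lt hxI.2 hq₀)
  exact hx p q hp1 (hp2.trans_le (min_le_right _ _)) ((le_max_right _ _).trans_lt hq1) hq2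
    ⟨hp2.trans_le (min_le_left _ _), (le_max_left _ _).trans_lt hq1⟩

/-! ### Integration by parts and the duality argument on slices -/

lemma integral_mul_primitive_add {f g : ℝ → ℝ} {a b : ℝ} (hf : IntervalIntegrable f volume a b)
    (hg : IntervalIntegrable g volume a b) :
    ∫ x in a..b, (f x * (∫ y in a..x, g y) + (∫ y in a..x, f y) * g x) =
      (∫ x in a..b, f x) * ∫ x in a..b, g x := by
  -- The primitives of integrable functions are absolutely continuous, so the product rule may be
  -- integrated.
  have h := (hf.absolutelyContinuousOnInterval_intervalIntegral
    left_mem_uIcc).integral_deriv_mul_eq_sub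
      (hg.absolutelyContinuousOnInterval_intervalIntegral left_mem_uIcc)
  simp only [intervalIntegral.integral_same, zero_mul, sub_zero] at h
  rw [← h]
  refine intervalIntegral.integral_congr_ae ?_
  filter_upwards [hf.ae_hasDerivAt_integral, hg.ae_hasDerivAt_integral] with x hx1 hx2 hx
  have hx' := uIoc_subset_uIcc hx
  rw [(hx1 hx' a left_mem_uIcc).deriv, (hx2 hx' a left_mem_uIcc).deriv]

/-- Integration by parts on an interval at whose end points the primitive `h` of `f` vanishes. -/
lemma integral_Ioo_eq_zero_of_primitive {f g u h : ℝ → ℝ} {a b m : ℝ} (hab : a < b)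
    (hf : Integrable f) (hg : Integrable g)
    (hu : ∀ᵐ x : ℝ, x ∈ Ioo a b → u x = m - ∫ y in Ici x, g y)
    (hh : ∀ᵐ x : ℝ, h x = -∫ y in Ici x, f y)
    (ha : ∫ y in Ici a, f y = 0) (hb : ∫ y in Ici b, f y = 0) :
    ∫ x in Ioo a b, (f x * u x + h x * g x) = 0 := by
  -- On the interval `u = M + ∫_a^x g` and `h = ∫_a^x f`. The integral is therefore `M ∫ f + (∫ f)(∫
  -- g)` over the interval, and `∫ f = 0` there.
  set M := m - ∫ y in Ici a, g y with hM
  have hfab : ∫ y in a..b, f y = 0 := by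
    have := integral_Ici_eq hf a b
    rw [ha, hb] at this
    linarith
  have hfi : IntervalIntegrable f volume a b := hf.intervalIntegrable
  have hgi : IntervalIntegrable g volume a b := hg.intervalIntegrable
  have hcg : Continuous fun x => ∫ y in a..x, g y :=
    intervalIntegral.continuous_primitive (fun _ _ => hg.intervalIntegrable) a
  have hcf : Continuous fun x => ∫ y in a..x, f y :=
    intervalIntegral.continuous_primitive (fun _ _ => hf.intervalIntegrable) a
  rw [← integral_Ioc_eq_integral_Ioo, ← intervalIntegral.integral_of_le hab.le]
  calc ∫ x in a..b, (f x * u x + h x * g x)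
      = ∫ x in a..b, (M * f x + (f x * (∫ y in a..x, g y) + (∫ y in a..x, f y) * g x)) := by
        refine intervalIntegral.integral_congr_ae ?_
        have hbne : ∀ᵐ x : ℝ, x ≠ b := by simp [ae_iff]
        filter_upwards [hu, hh, hbne] with x hx1 hx2 hxb hx
        rw [uIoc_of_le hab.le] at hx
        rw [hx1 ⟨hx.1, lt_of_le_of_ne hx.2 hxb⟩, hx2, integral_Ici_eq hf a x,
          integral_Ici_eq hg a x, ha]
        ring
    _ = 0 := by
        rw [intervalIntegral.integral_add (hfi.const_mul M), integral_mul_primitive_add hfi hgi,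
          intervalIntegral.integral_const_mul, hfab]
        · ring
        · exact (hfi.mul_continuousOn hcg.continuousOn).add
            (hgi.continuousOn_mul hcf.continuousOn)

/-- The outer interval at `x` has positive length, so vanishing almost everywhere there becomes
vanishing at its end point by continuity. This is where the domain must lie on one side of its
boundary: across a slit, functions in `C¹(closure Q)` could not approximate a jump. -/
lemma HasSeparatedBoundary.eq_zero_of_ae_notMem {δ : ℝ} (hδ : 0 < δ) {A : Set ℝ}
    (hA : HasSeparatedBoundary δ A) {F : ℝ → ℝ} (hF : Continuous F)
    (h0 : ∀ᵐ x : ℝ, x ∉ A → F x = 0) {x : ℝ} (hx : x ∈ frontier A) : F x = 0 := by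
  obtain ⟨e, he, hdisj⟩ := hA.exists_outer x hx
  have hne : x ≠ e := by
    rintro rfl
    rw [sub_self, abs_zero] at he
    linarith
  have hopen : IsOpen (uIoo x e) := isOpen_Ioo
  have hae : F =ᵐ[volume.restrict (uIoo x e)] fun _ => 0 := by
    filter_upwards [ae_restrict_of_ae h0, ae_restrict_mem hopen.measurableSet] with y hy hyI
    exact hy (disjoint_left.1 hdisj hyI)
  have h1 := (Measure.eqOn_open_of_ae_eq hae hopen hF.continuousOn continuousOn_const).closure
    hF continuous_const
  refine h1 ?_
  rw [uIoo, closure_Ioo (by simpa using hne)]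
  exact left_mem_uIcc

/-- A pair that annihilates all `(φ, ∂ₓ φ)` with `φ` smooth on the plane annihilates all
`(u, ∂ₓ u)` with `u` weakly differentiable in space in `Q`. -/
theorem integral_eq_zero_of_annihilates {Q : Set (ℝ × ℝ)} (hQ : IsOpen Q) {δ : ℝ} (hδ : 0 < δ)
    (hsep : ∀ᵐ t : ℝ, HasSeparatedBoundary δ (timeSlice Q t)) {f h u g : ℝ × ℝ → ℝ}
    (hfm : StronglyMeasurable f) (hf : Integrable f) (hh : Integrable h)
    (hum : StronglyMeasurable u) (hu : Integrable u) (hgm : StronglyMeasurable g)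
    (hg : Integrable g) (hf0 : ∀ z ∉ Q, f z = 0) (hh0 : ∀ z ∉ Q, h z = 0)
    (hfu : Integrable fun z => f z * u z) (hhg : Integrable fun z => h z * g z)
    (H : ∀ φ : ℝ × ℝ → ℝ, ContDiff ℝ ∞ φ →
      (∫ z, f z * φ z) + ∫ z, h z * fderiv ℝ φ z (1, 0) = 0)
    (W : ∀ φ : ℝ × ℝ → ℝ, ContDiff ℝ ∞ φ → HasCompactSupport φ → tsupport φ ⊆ Q →
      ∫ z, u z * fderiv ℝ φ z (1, 0) = -∫ z, g z * φ z) :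
    ∫ z, (f z * u z + h z * g z) = 0 := by
  have hslice : ∀ {f : ℝ × ℝ → ℝ}, Integrable f → ∀ᵐ t : ℝ, Integrable fun x => f (x, t) :=
    fun hf => Integrable.prod_left_ae (μ := (volume : Measure ℝ)) (ν := (volume : Measure ℝ)) hf
  have hi : Integrable fun z => f z * u z + h z * g z := hfu.add hhg
  rw [Measure.volume_eq_prod, integral_prod_symm _ hi]
  refine integral_eq_zero_of_ae ?_
  filter_upwards [hsep, ae_ae_slice (ae_eq_neg_integral_Ici hfm hf hh H),
    ae_forall_exists_ae_eq_sub_integral_Ici hQ hum hu hgm hg W, hslice hf, hslice hg,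
    hslice hi] with t hA hht hut hft hgt hit
  set A := timeSlice Q t
  have hF : ∀ x ∈ frontier A, ∫ y in Ici x, f (y, t) = 0 := fun x hx =>
    hA.eq_zero_of_ae_notMem hδ (continuous_integral_Ici hft) (by
      filter_upwards [hht] with y hy hyA
      have h1 : h (y, t) = 0 := hh0 _ hyA
      simp only [h1] at hy
      linarith) hx
  obtain ⟨s, b, hs, hdisj, heq⟩ := exists_finset_Ioo hA.isOpen hA.isBounded hA.finite_frontier
  have hzero : ∀ x ∉ A, f (x, t) * u (x, t) + h (x, t) * g (x, t) = 0 := fun x hx => by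
    rw [hf0 (x, t) hx, hh0 (x, t) hx]
    ring
  rw [← setIntegral_eq_integral_of_forall_compl_eq_zero hzero, heq,
    integral_biUnion_finset s (fun x _ => measurableSet_Ioo) hdisj fun x _ => hit.integrableOn]
  refine Finset.sum_eq_zero fun x hx => ?_
  obtain ⟨h1, h2, hlt, hsub⟩ := hs x hx
  obtain ⟨m, hm⟩ := hut x (b x) hlt hsub
  exact integral_Ioo_eq_zero_of_primitive (f := fun x => f (x, t)) (g := fun x => g (x, t))
    (u := fun x => u (x, t)) (h := fun x => h (x, t)) hlt hft hgt hm hht (hF x h1) (hF _ h2)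

/-! ### Weak derivatives of classical functions and uniqueness -/

lemma setIntegral_mul_test {Q : Set (ℝ × ℝ)} {u ψ : ℝ × ℝ → ℝ} (hψ : tsupport ψ ⊆ Q) :
    ∫ z in Q, u z * ψ z = ∫ z, u z * ψ z :=
  setIntegral_eq_integral_of_forall_compl_eq_zero fun z hz => by
    rw [image_eq_zero_of_notMem_tsupport fun h => hz (hψ h), mul_zero]

lemma tsupport_dx_subset (φ : ℝ × ℝ → ℝ) :
    tsupport (fun z => fderiv ℝ φ z (1, 0)) ⊆ tsupport φ :=
  tsupport_fderiv_apply_subset ℝ _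

lemma integrable_mul_of_continuousOn {Q : Set (ℝ × ℝ)} {u ψ : ℝ × ℝ → ℝ} (hu : ContinuousOn u Q)
    (hψ : Continuous ψ) (hc : HasCompactSupport ψ) (hs : tsupport ψ ⊆ Q) :
    Integrable fun z => u z * ψ z := by
  refine (integrableOn_iff_integrable_of_support_subset (s := tsupport ψ) ?_).1
    (((hu.mono hs).mul hψ.continuousOn).integrableOn_compact hc)
  exact (Function.support_mul_subset_right u ψ).trans (subset_tsupport ψ)

/-- Integration by parts against a test function. -/
lemma integral_mul_dx_test {Q : Set (ℝ × ℝ)} (hQ : IsOpen Q) {φ ψ : ℝ × ℝ → ℝ}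
    (hφ : ContDiffOn ℝ 1 φ Q) (hψ : ContDiff ℝ ∞ ψ) (hc : HasCompactSupport ψ)
    (hs : tsupport ψ ⊆ Q) :
    ∫ z in Q, φ z * fderiv ℝ ψ z (1, 0) = -∫ z in Q, fderiv ℝ φ z (1, 0) * ψ z := by
  rw [setIntegral_mul_test hs, setIntegral_mul_test ((tsupport_dx_subset ψ).trans hs)]
  refine integral_mul_fderiv_eq_neg_fderiv_mul_of_integrable ?_ ?_ ?_ ?_ ?_
  · exact integrable_mul_of_continuousOn ((hφ.continuousOn_fderiv_of_isOpen hQ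
      le_rfl).clm_apply continuousOn_const) hψ.continuous hc hs
  · exact integrable_mul_of_continuousOn hφ.continuousOn (continuous_dx_test hψ)
      (hc.fderiv_apply ℝ _) ((tsupport_dx_subset ψ).trans hs)
  · exact integrable_mul_of_continuousOn hφ.continuousOn hψ.continuous hc hs
  · exact fun z hz => (hφ.differentiableOn (by simp)).differentiableAt (hQ.mem_nhds (hs hz))
  · exact fun z _ => hψ.differentiable (by simp) z

lemma isWeakDx_of_ae_eq {Q : Set (ℝ × ℝ)} (hQ : IsOpen Q) {φ : ℝ × ℝ → ℝ}
    (hφ : ContDiffOn ℝ 1 φ Q) {u g : L2 Q} (hu : u =ᵐ[volume.restrict Q] φ)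
    (hg : g =ᵐ[volume.restrict Q] fun z => fderiv ℝ φ z (1, 0)) : IsWeakDx Q u g := by
  intro ψ hψ hc hs
  rw [integral_congr_ae (hu.mono fun z hz => by rw [hz]),
    integral_congr_ae (f := fun z => g z * ψ z) (hg.mono fun z hz => by beta_reduce; rw [hz]),
    integral_mul_dx_test hQ hφ hψ hc hs]

lemma IsWeakDx.ae_eq {Q : Set (ℝ × ℝ)} (hQ : IsOpen Q) {φ : ℝ × ℝ → ℝ}
    (hφ : ContDiffOn ℝ 1 φ Q) {u g : L2 Q} (hu : u =ᵐ[volume.restrict Q] φ)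
    (hg : IsWeakDx Q u g) : g =ᵐ[volume.restrict Q] fun z => fderiv ℝ φ z (1, 0) := by
  have hφc : ContinuousOn (fun z => fderiv ℝ φ z (1, 0)) Q :=
    (hφ.continuousOn_fderiv_of_isOpen hQ le_rfl).clm_apply continuousOn_const
  have hl : LocallyIntegrableOn (fun z => g z - fderiv ℝ φ z (1, 0)) Q (volume.restrict Q) :=
    (((Lp.memLp g).locallyIntegrable (by norm_num)).locallyIntegrableOn Q).sub
      (hφc.locallyIntegrableOn hQ.measurableSet)
  have h0 := hQ.ae_eq_zero_of_integral_contDiff_smul_eq_zero hl fun ψ hψ hc hs => by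
    have h1 := hg ψ hψ hc hs
    rw [integral_congr_ae (hu.mono fun z hz => by rw [hz]),
      integral_mul_dx_test hQ hφ hψ hc hs] at h1
    have hi : Integrable (fun z => fderiv ℝ φ z (1, 0) * ψ z) (volume.restrict Q) :=
      (integrable_mul_of_continuousOn hφc hψ.continuous hc hs).integrableOn
    rw [integral_congr_ae (g := fun z => g z * ψ z - fderiv ℝ φ z (1, 0) * ψ z)
      (ae_of_all _ fun z => by simp only [smul_eq_mul]; ring),
      integral_sub (integrable_mul_test g hψ.continuous hc) hi]
    linarith
  filter_upwards [h0, ae_restrict_mem hQ.measurableSet] with z hz hzQ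
  exact sub_eq_zero.1 (hz hzQ)

/-- The difference is a weak derivative of the classical function `0`. Uniqueness is what makes the
chosen derivative `dx` linear. -/
lemma IsWeakDx.unique {Q : Set (ℝ × ℝ)} (hQ : IsOpen Q) {u g k : L2 Q}
    (hg : IsWeakDx Q u g) (hk : IsWeakDx Q u k) : g = k := by
  have h : IsWeakDx Q 0 (g - k) := by
    have := hg.add (hk.smul (-1))
    rwa [neg_one_smul, neg_one_smul, add_neg_cancel, ← sub_eq_add_neg] at this
  have h0 := h.ae_eq hQ (φ := fun _ => 0) contDiffOn_const (Lp.coeFn_zero _ _ _)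
  rw [← sub_eq_zero]
  refine Lp.ext ?_
  filter_upwards [h0, Lp.coeFn_zero ℝ 2 (volume.restrict Q)] with z hz hz0
  rw [hz0]
  simpa using hz

lemma isWeakDx_dx {Q : Set (ℝ × ℝ)} (u : H10 Q) : IsWeakDx Q u (dx u) :=
  Classical.choose_spec u.2

lemma dx_add {Q : Set (ℝ × ℝ)} (hQ : IsOpen Q) (u v : H10 Q) : dx (u + v) = dx u + dx v :=
  (isWeakDx_dx (u + v)).unique hQ ((isWeakDx_dx u).add (isWeakDx_dx v))

lemma dx_smul {Q : Set (ℝ × ℝ)} (hQ : IsOpen Q) (c : ℝ) (u : H10 Q) : dx (c • u) = c • dx u :=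
  (isWeakDx_dx (c • u)).unique hQ ((isWeakDx_dx u).smul c)

/-! ### The graph norm and density of classical functions -/

/-- The map `u ↦ (u, ∂ₓ u)` into a Hilbert space. -/
noncomputable def graphMap {Q : Set (ℝ × ℝ)} (hQ : IsOpen Q) :
    H10 Q →ₗ[ℝ] WithLp 2 (L2 Q × L2 Q) where
  toFun u := WithLp.toLp 2 ((u : L2 Q), dx u)
  map_add' u v := by rw [dx_add hQ]; rfl
  map_smul' c u := by rw [dx_smul hQ]; rfl

lemma norm_graphMap_sq {Q : Set (ℝ × ℝ)} (hQ : IsOpen Q) (u : H10 Q) :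
    ‖graphMap hQ u‖ ^ 2 = ‖(u : L2 Q)‖ ^ 2 + ‖dx u‖ ^ 2 :=
  WithLp.prod_norm_sq_eq_of_L2 _

lemma norm_graphMap_le_h10Norm {Q : Set (ℝ × ℝ)} (hQ : IsOpen Q) (u : H10 Q) :
    ‖graphMap hQ u‖ ≤ h10Norm u := by
  refine Real.le_sqrt_of_sq_le ?_
  rw [norm_graphMap_sq]
  exact le_add_of_nonneg_right (sq_nonneg _)

lemma h10Norm_le_two_mul {Q : Set (ℝ × ℝ)} (hQ : IsOpen Q) (u : H10 Q) :
    h10Norm u ≤ 2 * ‖graphMap hQ u‖ := by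
  refine Real.sqrt_le_iff.2 ⟨by positivity, ?_⟩
  rw [mul_pow, norm_graphMap_sq]
  nlinarith [sq_nonneg ‖(u : L2 Q)‖, sq_nonneg ‖dx u‖]

/-- The elements of `H^{1,0}(Q)` with a representative in `C¹(closure Q)`. -/
def classicalH10 (Q : Set (ℝ × ℝ)) : Submodule ℝ (H10 Q) where
  carrier := {u | ∃ φ : ℝ × ℝ → ℝ, ContDiffOn ℝ 1 φ (closure Q) ∧
    ((u : L2 Q) : ℝ × ℝ → ℝ) =ᵐ[volume.restrict Q] φ}
  zero_mem' := ⟨0, contDiffOn_const, Lp.coeFn_zero _ _ _⟩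
  add_mem' := fun ⟨φ, hφ, hu⟩ ⟨ψ, hψ, hv⟩ =>
    ⟨φ + ψ, hφ.add hψ, (Lp.coeFn_add _ _).trans (hu.add hv)⟩
  smul_mem' := fun c _ ⟨φ, hφ, hu⟩ =>
    ⟨c • φ, hφ.const_smul c, (Lp.coeFn_smul c _).trans (hu.const_smul c)⟩

lemma memLp_two_of_continuous {Q : Set (ℝ × ℝ)} (hQm : MeasurableSet Q)
    (hb : Bornology.IsBounded Q) {φ : ℝ × ℝ → ℝ} (hφ : Continuous φ) :
    MemLp φ 2 (volume.restrict Q) := by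
  have : IsFiniteMeasure ((volume : Measure (ℝ × ℝ)).restrict Q) :=
    ⟨by rw [Measure.restrict_apply_univ]; exact hb.measure_lt_top⟩
  obtain ⟨C, hC⟩ := hb.isCompact_closure.exists_bound_of_continuousOn hφ.continuousOn
  exact MemLp.of_bound hφ.aestronglyMeasurable C
    ((ae_restrict_mem hQm).mono fun z hz => hC z (subset_closure hz))

lemma exists_classicalH10 {Q : Set (ℝ × ℝ)} (hQ : IsOpen Q) (hb : Bornology.IsBounded Q)
    {φ : ℝ × ℝ → ℝ} (hφ : ContDiff ℝ ∞ φ) :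
    ∃ u ∈ classicalH10 Q, (u : L2 Q) =ᵐ[volume.restrict Q] φ ∧
      dx u =ᵐ[volume.restrict Q] fun z => fderiv ℝ φ z (1, 0) := by
  have hφ1 : ContDiff ℝ 1 φ := hφ.of_le (by exact_mod_cast le_top)
  have h1 := memLp_two_of_continuous hQ.measurableSet hb hφ.continuous
  have h2 := memLp_two_of_continuous hQ.measurableSet hb (continuous_dx_test hφ)
  have hw := isWeakDx_of_ae_eq hQ hφ1.contDiffOn h1.coeFn_toLp h2.coeFn_toLp
  refine ⟨⟨h1.toLp φ, _, hw⟩, ⟨φ, hφ1.contDiffOn, h1.coeFn_toLp⟩, h1.coeFn_toLp, ?_⟩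
  exact (isWeakDx_dx ⟨h1.toLp φ, _, hw⟩).ae_eq hQ hφ1.contDiffOn h1.coeFn_toLp

lemma integrable_indicator_L2 {Q : Set (ℝ × ℝ)} (hQm : MeasurableSet Q)
    (hb : Bornology.IsBounded Q) (u : L2 Q) : Integrable (Q.indicator u) := by
  have : IsFiniteMeasure ((volume : Measure (ℝ × ℝ)).restrict Q) :=
    ⟨by rw [Measure.restrict_apply_univ]; exact hb.measure_lt_top⟩
  rw [integrable_indicator_iff hQm]
  exact (Lp.memLp u).integrable (by norm_num)

lemma integrable_indicator_mul {Q : Set (ℝ × ℝ)} (hQm : MeasurableSet Q) (f u : L2 Q) :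
    Integrable fun z => Q.indicator f z * Q.indicator u z := by
  have h : (fun z => Q.indicator f z * Q.indicator u z) = Q.indicator fun z => f z * u z := by
    funext z
    by_cases hz : z ∈ Q
    · simp [hz]
    · simp [hz]
  rw [h, integrable_indicator_iff hQm]
  exact (Lp.memLp f).integrable_mul (Lp.memLp u)

lemma integral_indicator_mul {Q : Set (ℝ × ℝ)} (hQm : MeasurableSet Q) (u φ : ℝ × ℝ → ℝ) :
    ∫ z, Q.indicator u z * φ z = ∫ z in Q, u z * φ z := by
  rw [← integral_indicator hQm]
  refine integral_congr_ae (ae_of_all _ fun z => ?_)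
  by_cases hz : z ∈ Q
  · simp [hz]
  · simp [hz]

lemma inner_L2_eq {Q : Set (ℝ × ℝ)} (f u : L2 Q) :
    inner ℝ f u = ∫ z in Q, f z * u z := by
  rw [L2.inner_def]
  refine integral_congr_ae (ae_of_all _ fun z => ?_)
  simp [mul_comm]

/-- The functions in `C¹(closure Q)` are dense in `H^{1,0}(Q)`. -/
theorem graphMap_mem_topologicalClosure {Q : Set (ℝ × ℝ)} (hQ : IsOpen Q)
    (hb : Bornology.IsBounded Q) {δ : ℝ} (hδ : 0 < δ)
    (hsep : ∀ᵐ t : ℝ, HasSeparatedBoundary δ (timeSlice Q t)) (u : H10 Q) :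
    graphMap hQ u ∈ ((classicalH10 Q).map (graphMap hQ)).topologicalClosure := by
  have hQm := hQ.measurableSet
  -- In a Hilbert space the closure is the double orthogonal complement, so it suffices that every
  -- `w = (f, h)` orthogonal to the classical pairs is orthogonal to `(u, ∂ₓu)`. Extending by zero
  -- outside `Q` turns this into an identity on the plane.
  rw [← Submodule.orthogonal_orthogonal_eq_closure, Submodule.mem_orthogonal]
  intro w hw
  rw [Submodule.mem_orthogonal'] at hw
  set f : L2 Q := (WithLp.ofLp w).1
  set h : L2 Q := (WithLp.ofLp w).2
  have hsm : ∀ v : L2 Q, StronglyMeasurable (Q.indicator v) := fun v =>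
    (Lp.stronglyMeasurable v).indicator hQm
  have hW := integral_eq_zero_of_annihilates hQ hδ hsep (hsm f)
    (integrable_indicator_L2 hQm hb f) (integrable_indicator_L2 hQm hb h) (hsm u)
    (integrable_indicator_L2 hQm hb u) (hsm (dx u)) (integrable_indicator_L2 hQm hb (dx u))
    (fun z hz => indicator_of_notMem hz _) (fun z hz => indicator_of_notMem hz _)
    (integrable_indicator_mul hQm f u) (integrable_indicator_mul hQm h (dx u)) ?_ ?_
  · rw [integral_add (integrable_indicator_mul hQm f u) (integrable_indicator_mul hQm h (dx u)),
      integral_indicator_mul hQm, integral_indicator_mul hQm] at hW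
    rw [WithLp.prod_inner_apply]
    change inner ℝ f (u : L2 Q) + inner ℝ h (dx u) = 0
    rw [inner_L2_eq, inner_L2_eq, ← hW]
    congr 1
    · exact setIntegral_congr_fun hQm fun z hz => by rw [indicator_of_mem hz]
    · exact setIntegral_congr_fun hQm fun z hz => by rw [indicator_of_mem hz]
  · intro φ hφ
    obtain ⟨v, hvc, hv, hdv⟩ := exists_classicalH10 hQ hb hφ
    have h1 := hw (graphMap hQ v) (Submodule.mem_map_of_mem hvc)
    rw [WithLp.prod_inner_apply] at h1
    change inner ℝ f (v : L2 Q) + inner ℝ h (dx v) = 0 at h1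
    rw [inner_L2_eq, inner_L2_eq] at h1
    rw [integral_indicator_mul hQm, integral_indicator_mul hQm]
    refine Eq.trans ?_ h1
    congr 1
    · exact integral_congr_ae (hv.mono fun z hz => by beta_reduce; rw [hz])
    · exact integral_congr_ae (hdv.mono fun z hz => by beta_reduce; rw [hz])
  · intro φ hφ hc hs
    rw [integral_indicator_mul hQm, integral_indicator_mul hQm]
    exact isWeakDx_dx u φ hφ hc hs

/-! ### The trace operator and the Poincaré inequality -/

lemma Lp.enorm_sq_eq_lintegral {α : Type*} [MeasurableSpace α] {μ : Measure α} (v : Lp ℝ 2 μ)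
    {f : α → ℝ} (h : v =ᵐ[μ] f) : ‖v‖ₑ ^ 2 = ∫⁻ z, ‖f z‖ₑ ^ 2 ∂μ := by
  have h1 := eLpNorm_nnreal_pow_eq_lintegral (μ := μ) (f := v) (p := 2) two_ne_zero
  rw [Lp.enorm_def, ← lintegral_congr_ae (f := fun z => ‖v z‖ₑ ^ 2)
    (h.mono fun z hz => by beta_reduce; rw [hz])]
  simpa using h1

lemma ae_mem_lateral {Ω : ℝ → Set ℝ} {T : ℝ} (hQ : IsOpen (spaceTime Ω T)) :
    ∀ᵐ z ∂arcLength (lateral Ω T), z ∈ lateral Ω T :=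
  ae_restrict_mem (measurableSet_lateral hQ)

/-- Two functions in `C(closure Q)` that agree almost everywhere in `Q` agree on the closure. -/
lemma eqOn_closure_of_ae_eq {Q : Set (ℝ × ℝ)} (hQ : IsOpen Q) {φ ψ : ℝ × ℝ → ℝ}
    (hφ : ContinuousOn φ (closure Q)) (hψ : ContinuousOn ψ (closure Q))
    (h : φ =ᵐ[volume.restrict Q] ψ) : EqOn φ ψ (closure Q) :=
  (Measure.eqOn_open_of_ae_eq h hQ (hφ.mono subset_closure)
    (hψ.mono subset_closure)).of_subset_closure hφ hψ subset_closure le_rfl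

namespace HasLateralCurves

variable {Ω : ℝ → Set ℝ} {T δ : ℝ} {F : Set ℝ} {N : ℕ} {K : ℝ≥0} {c : Fin N → ℝ → ℝ}

/-- A function in `C¹(closure Q)` may be replaced by a measurable one. -/
lemma exists_measurable_representative (h : HasLateralCurves Ω T δ F K c) {u : H10 (spaceTime Ω T)}
    {φ : ℝ × ℝ → ℝ} (hφ : ContDiffOn ℝ 1 φ (closure (spaceTime Ω T)))
    (hu : (u : L2 (spaceTime Ω T)) =ᵐ[volume.restrict (spaceTime Ω T)] φ) :
    ∃ φ' q : ℝ × ℝ → ℝ, Measurable φ' ∧ Measurable q ∧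
      ContinuousOn φ' (closure (spaceTime Ω T)) ∧
      (∀ z ∈ spaceTime Ω T, HasDerivAt (fun x => φ' (x, z.2)) (q z) z.1) ∧
      φ' =ᵐ[arcLength (lateral Ω T)] φ ∧ ‖(u : L2 (spaceTime Ω T))‖ₑ ^ 2 =
        ∫⁻ z in spaceTime Ω T, ‖φ' z‖ₑ ^ 2 ∧
      ‖dx u‖ₑ ^ 2 = ∫⁻ z in spaceTime Ω T, ‖q z‖ₑ ^ 2 := by
  have hQ : IsOpen (spaceTime Ω T) := h.isOpen
  have heq : EqOn ((closure (spaceTime Ω T)).indicator φ) φ (closure (spaceTime Ω T)) :=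
    fun z hz => indicator_of_mem hz _
  have hφQ : ContDiffOn ℝ 1 φ (spaceTime Ω T) := hφ.mono subset_closure
  -- Outside `closure Q` nothing is known about `φ`, so it is cut off there. The lateral boundary
  -- lies in the closure and is not affected.
  refine ⟨(closure (spaceTime Ω T)).indicator φ, fun z => fderiv ℝ φ z (1, 0), ?_,
    measurable_fderiv_apply_const ℝ φ (1, 0), hφ.continuousOn.congr heq, ?_, ?_, ?_, ?_⟩
  · classical
    rw [← piecewise_eq_indicator]
    exact hφ.continuousOn.measurable_piecewise continuousOn_const isClosed_closure.measurableSet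
  · intro z hz
    have hd := hasDerivAt_fderiv_dx
      ((hφQ.differentiableOn (by simp)).differentiableAt (hQ.mem_nhds hz))
    refine hd.congr_of_eventuallyEq ?_
    filter_upwards [(isOpen_timeSlice hQ z.2).mem_nhds hz] with x hx
    exact heq (subset_closure hx)
  · filter_upwards [ae_mem_lateral hQ] with z hz
    exact heq (lateral_subset_closure hz)
  · refine Lp.enorm_sq_eq_lintegral _ (hu.trans ?_)
    filter_upwards [ae_restrict_mem hQ.measurableSet] with z hz
    exact (heq (subset_closure hz)).symm
  · exact Lp.enorm_sq_eq_lintegral _ ((isWeakDx_dx u).ae_eq hQ hφQ hu)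

theorem exists_trace_bound (h : HasLateralCurves Ω T δ F K c) :
    ∃ M : ℝ, ∀ (u : H10 (spaceTime Ω T)) (φ : ℝ × ℝ → ℝ),
      ContDiffOn ℝ 1 φ (closure (spaceTime Ω T)) →
      (u : L2 (spaceTime Ω T)) =ᵐ[volume.restrict (spaceTime Ω T)] φ →
      MemLp φ 2 (arcLength (lateral Ω T)) ∧ ∀ v : L2Lateral (lateral Ω T),
        v =ᵐ[arcLength (lateral Ω T)] φ → ‖v‖ ≤ M * ‖graphMap h.isOpen u‖ := by
  obtain ⟨M, hM⟩ := h.exists_lintegral_arcLength_le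
  refine ⟨√M, fun u φ hφ hu => ?_⟩
  obtain ⟨φ', q, h1, h2, h3, h4, h5, h6, h7⟩ := h.exists_measurable_representative hφ hu
  have hb := hM φ' q h1 h2 h3 h4
  rw [← h6, ← h7] at hb
  have hmem : MemLp φ' 2 (arcLength (lateral Ω T)) := by
    refine ⟨h1.aestronglyMeasurable, ?_⟩
    have e1 := eLpNorm_nnreal_pow_eq_lintegral (μ := arcLength (lateral Ω T)) (f := φ') (p := 2)
      two_ne_zero
    have e2 : ∫⁻ z, ‖φ' z‖ₑ ^ 2 ∂arcLength (lateral Ω T) < ⊤ :=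
      hb.trans_lt (ENNReal.mul_lt_top ENNReal.coe_lt_top
        (ENNReal.add_lt_top.2 ⟨by simp, by simp⟩))
    by_contra htop
    rw [not_lt, top_le_iff] at htop
    have e3 : eLpNorm φ' ((2 : ℝ≥0) : ℝ≥0∞) (arcLength (lateral Ω T)) = ⊤ := by simpa using htop
    rw [e3] at e1
    simp only [NNReal.coe_ofNat, ENNReal.rpow_ofNat] at e1
    rw [← e1] at e2
    simp at e2
  refine ⟨(memLp_congr_ae h5).1 hmem, fun v hv => ?_⟩
  rw [← Lp.enorm_sq_eq_lintegral v (hv.trans h5.symm)] at hb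
  have hr : ‖v‖ ^ 2 ≤ M * (‖(u : L2 (spaceTime Ω T))‖ ^ 2 + ‖dx u‖ ^ 2) := by
    have := ENNReal.toReal_mono (by simp [ENNReal.mul_eq_top]) hb
    rw [ENNReal.toReal_mul, ENNReal.toReal_add (by simp) (by simp)] at this
    simpa using this
  rw [← norm_graphMap_sq h.isOpen] at hr
  refine (pow_le_pow_iff_left₀ (norm_nonneg _) (by positivity) two_ne_zero).1 ?_
  rwa [mul_pow, Real.sq_sqrt (NNReal.coe_nonneg M)]

theorem poincare_of_classical (h : HasLateralCurves Ω T δ F K c) {C : ℝ} (hC0 : 0 < C)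
    (hC : ∀ t, volume (timeSlice (spaceTime Ω T) t) ≤ ENNReal.ofReal C)
    {u : H10 (spaceTime Ω T)} {φ : ℝ × ℝ → ℝ}
    (hφ : ContDiffOn ℝ 1 φ (closure (spaceTime Ω T)))
    (hu : (u : L2 (spaceTime Ω T)) =ᵐ[volume.restrict (spaceTime Ω T)] φ)
    {v : L2Lateral (lateral Ω T)} (hv : v =ᵐ[arcLength (lateral Ω T)] φ) :
    ‖(u : L2 (spaceTime Ω T))‖ ≤ (2 * C + 1) * (‖dx u‖ + ‖v‖) := by
  obtain ⟨φ', q, h1, h2, h3, h4, h5, h6, h7⟩ := h.exists_measurable_representative hφ hu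
  have hb := h.lintegral_enorm_sq_le ENNReal.ofReal_ne_top hC h1 h2 h3 h4
  rw [← h6, ← h7, ← Lp.enorm_sq_eq_lintegral v (hv.trans h5.symm)] at hb
  have hr : ‖(u : L2 (spaceTime Ω T))‖ ^ 2 ≤ 2 * (C * ‖v‖ ^ 2) + 2 * (C ^ 2 * ‖dx u‖ ^ 2) := by
    have := ENNReal.toReal_mono (by simp [ENNReal.mul_eq_top]) hb
    rw [ENNReal.toReal_add (by simp [ENNReal.mul_eq_top]) (by simp [ENNReal.mul_eq_top])] at this
    simpa [ENNReal.toReal_mul, hC0.le] using this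
  -- The constant `2 * C + 1` is chosen because its square dominates both `2 * C` and `2 * C ^ 2`.
  refine (pow_le_pow_iff_left₀ (norm_nonneg _) (by positivity) two_ne_zero).1 (hr.trans ?_)
  have p1 := norm_nonneg (dx u)
  have p2 := norm_nonneg v
  nlinarith [mul_nonneg p1 p2, mul_nonneg hC0.le (mul_nonneg p1 p2), mul_nonneg hC0.le (sq_nonneg ‖v‖),
    mul_nonneg hC0.le (sq_nonneg ‖dx u‖), mul_nonneg (sq_nonneg C) (mul_nonneg p1 p2),
    mul_nonneg (sq_nonneg C) (sq_nonneg ‖v‖), mul_nonneg (sq_nonneg C) (sq_nonneg ‖dx u‖),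
    sq_nonneg ‖v‖, sq_nonneg ‖dx u‖]

/-- Approximation of an element of `H^{1,0}(Q)` by classical functions. -/
lemma exists_seq_tendsto (h : HasLateralCurves Ω T δ F K c) (u : H10 (spaceTime Ω T)) :
    ∃ w : ℕ → H10 (spaceTime Ω T), (∀ n, w n ∈ classicalH10 (spaceTime Ω T)) ∧
      Tendsto (fun n => ‖graphMap h.isOpen (u - w n)‖) atTop (𝓝 0) := by
  have hmem := graphMap_mem_topologicalClosure h.isOpen h.isBounded h.pos
    (h.ae_notMem.mono h.separated) u
  obtain ⟨x, hx, hlim⟩ := mem_closure_iff_seq_limit.1 hmem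
  choose w hw hwx using hx
  refine ⟨w, hw, ?_⟩
  have h1 := (tendsto_const_nhds (x := graphMap h.isOpen u)).sub hlim
  rw [sub_self] at h1
  simpa [map_sub, hwx] using h1.norm

lemma _root_.IsTraceOperator.exists_norm_le {Q S : Set (ℝ × ℝ)} (hQ : IsOpen Q)
    {γ : H10 Q →ₗ[ℝ] L2Lateral S} (hγ : IsTraceOperator Q S γ) :
    ∃ K : ℝ, ∀ u, ‖γ u‖ ≤ K * ‖graphMap hQ u‖ := by
  obtain ⟨⟨K, hK⟩, -⟩ := hγ
  refine ⟨|K| * 2, fun u => (hK u).trans ?_⟩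
  calc K * h10Norm u ≤ |K| * (2 * ‖graphMap hQ u‖) :=
        mul_le_mul (le_abs_self K) (h10Norm_le_two_mul hQ u) (Real.sqrt_nonneg _) (abs_nonneg K)
    _ = _ := by ring

lemma tendsto_trace (h : HasLateralCurves Ω T δ F K c)
    {γ : H10 (spaceTime Ω T) →ₗ[ℝ] L2Lateral (lateral Ω T)}
    (hγ : IsTraceOperator (spaceTime Ω T) (lateral Ω T) γ) {u : H10 (spaceTime Ω T)}
    {w : ℕ → H10 (spaceTime Ω T)}
    (hw : Tendsto (fun n => ‖graphMap h.isOpen (u - w n)‖) atTop (𝓝 0)) :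
    Tendsto (fun n => γ (w n)) atTop (𝓝 (γ u)) := by
  obtain ⟨M, hM⟩ := hγ.exists_norm_le h.isOpen
  rw [tendsto_iff_norm_sub_tendsto_zero]
  have hlim := hw.const_mul M
  rw [mul_zero] at hlim
  refine squeeze_zero (fun n => norm_nonneg _) (fun n => ?_) hlim
  rw [norm_sub_rev, ← map_sub γ]
  exact hM _

theorem trace_unique (h : HasLateralCurves Ω T δ F K c)
    {γ γ' : H10 (spaceTime Ω T) →ₗ[ℝ] L2Lateral (lateral Ω T)}
    (hγ : IsTraceOperator (spaceTime Ω T) (lateral Ω T) γ)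
    (hγ' : IsTraceOperator (spaceTime Ω T) (lateral Ω T) γ') : γ = γ' := by
  refine LinearMap.ext fun u => ?_
  obtain ⟨w, hw, hlim⟩ := h.exists_seq_tendsto u
  refine tendsto_nhds_unique (h.tendsto_trace hγ hlim)
    ((h.tendsto_trace hγ' hlim).congr fun n => ?_)
  obtain ⟨φ, hφ, hwφ⟩ := hw n
  exact Lp.ext ((hγ'.2 φ hφ _ hwφ).trans (hγ.2 φ hφ _ hwφ).symm)

theorem poincare (h : HasLateralCurves Ω T δ F K c) {C : ℝ} (hC0 : 0 < C)
    (hC : ∀ t, volume (timeSlice (spaceTime Ω T) t) ≤ ENNReal.ofReal C)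
    {γ : H10 (spaceTime Ω T) →ₗ[ℝ] L2Lateral (lateral Ω T)}
    (hγ : IsTraceOperator (spaceTime Ω T) (lateral Ω T) γ) (u : H10 (spaceTime Ω T)) :
    ‖(u : L2 (spaceTime Ω T))‖ ≤ (2 * C + 1) * (‖dx u‖ + ‖γ u‖) := by
  obtain ⟨w, hw, hlim⟩ := h.exists_seq_tendsto u
  have hlimG : Tendsto (fun n => graphMap h.isOpen (w n)) atTop (𝓝 (graphMap h.isOpen u)) := by
    rw [tendsto_iff_norm_sub_tendsto_zero]
    exact hlim.congr fun n => by rw [norm_sub_rev, ← map_sub]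
  have h1 : Tendsto (fun n => (w n : L2 (spaceTime Ω T))) atTop (𝓝 u) :=
    ((WithLp.prod_continuous_ofLp 2 _ _).fst.tendsto _).comp hlimG
  have h2 : Tendsto (fun n => dx (w n)) atTop (𝓝 (dx u)) :=
    ((WithLp.prod_continuous_ofLp 2 _ _).snd.tendsto _).comp hlimG
  have h3 := h.tendsto_trace hγ hlim
  refine le_of_tendsto_of_tendsto h1.norm ((h2.norm.add h3.norm).const_mul _)
    (Eventually.of_forall fun n => ?_)
  obtain ⟨φ, hφ, hwφ⟩ := hw n
  exact h.poincare_of_classical hC0 hC hφ hwφ (hγ.2 φ hφ _ hwφ)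

/-- Restriction to the lateral boundary, bounded in the graph norm on classical functions, extends
to the closure `E` of their graphs. By density the graph of every element of `H10 Q` lies in `E`, so
composing with `j` defines the trace without putting a topology on `H10 Q`. -/
theorem exists_isTraceOperator (h : HasLateralCurves Ω T δ F K c) :
    ∃ γ, IsTraceOperator (spaceTime Ω T) (lateral Ω T) γ := by
  set Q := spaceTime Ω T
  set S := lateral Ω T
  have hQ : IsOpen Q := h.isOpen
  obtain ⟨M, hM⟩ := h.exists_trace_bound
  choose Φ hΦ hΦu using fun u : classicalH10 Q => u.2
  have hmem : ∀ u : classicalH10 Q, MemLp (Φ u) 2 (arcLength S) := fun u =>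
    (hM u (Φ u) (hΦ u) (hΦu u)).1
  -- The boundary values do not depend on the representative; this makes the restriction of the
  -- chosen representatives linear.
  have hS : ∀ φ ψ : ℝ × ℝ → ℝ, ContDiffOn ℝ 1 φ (closure Q) → ContDiffOn ℝ 1 ψ (closure Q) →
      φ =ᵐ[volume.restrict Q] ψ → φ =ᵐ[arcLength S] ψ := fun φ ψ hφ hψ he => by
    filter_upwards [ae_mem_lateral hQ] with z hz
    exact eqOn_closure_of_ae_eq hQ hφ.continuousOn hψ.continuousOn he (lateral_subset_closure hz)
  let γ₀ : classicalH10 Q →ₗ[ℝ] L2Lateral S :=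
    { toFun := fun u => (hmem u).toLp (Φ u)
      map_add' := fun u v => by
        rw [← MemLp.toLp_add]
        refine (MemLp.toLp_eq_toLp_iff _ _).2 (hS _ _ (hΦ _) ((hΦ u).add (hΦ v)) ?_)
        exact (hΦu (u + v)).symm.trans ((Lp.coeFn_add _ _).trans ((hΦu u).add (hΦu v)))
      map_smul' := fun r u => by
        rw [RingHom.id_apply, ← MemLp.toLp_const_smul]
        refine (MemLp.toLp_eq_toLp_iff _ _).2 (hS _ _ (hΦ _) ((hΦ u).const_smul r) ?_)
        exact (hΦu (r • u)).symm.trans ((Lp.coeFn_smul r _).trans ((hΦu u).const_smul r)) }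
  have hγ₀ : ∀ u, (γ₀ u : ℝ × ℝ → ℝ) =ᵐ[arcLength S] Φ u := fun u => (hmem u).coeFn_toLp
  let E := ((classicalH10 Q).map (graphMap hQ)).topologicalClosure
  let e : classicalH10 Q →ₗ[ℝ] E := ((graphMap hQ).comp (classicalH10 Q).subtype).codRestrict E
    fun u => Submodule.le_topologicalClosure _ (Submodule.mem_map_of_mem u.2)
  let j : H10 Q →ₗ[ℝ] E := (graphMap hQ).codRestrict E fun u =>
    graphMap_mem_topologicalClosure hQ h.isBounded h.pos (h.ae_notMem.mono h.separated) u
  have hdense : DenseRange e := by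
    intro x
    rw [closure_subtype]
    refine closure_mono ?_ x.2
    rintro _ ⟨u, hu, rfl⟩
    exact ⟨e ⟨u, hu⟩, ⟨⟨u, hu⟩, rfl⟩, rfl⟩
  have hnorm : ∀ u, ‖γ₀ u‖ ≤ M * ‖e u‖ := fun u =>
    (hM u (Φ u) (hΦ u) (hΦu u)).2 _ (hγ₀ u)
  refine ⟨(γ₀.extendOfNorm e).toLinearMap.comp j, ⟨|M|, fun u => ?_⟩, fun φ hφ u hu => ?_⟩
  · calc ‖γ₀.extendOfNorm e (j u)‖ ≤ M * ‖j u‖ :=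
          LinearMap.norm_extendOfNorm_apply_le hdense M hnorm _
      _ ≤ |M| * h10Norm u := mul_le_mul (le_abs_self M) (norm_graphMap_le_h10Norm hQ u)
          (norm_nonneg _) (abs_nonneg M)
  · have he : γ₀.extendOfNorm e (j u) = γ₀ ⟨u, φ, hφ, hu⟩ :=
      LinearMap.extendOfNorm_eq hdense ⟨M, hnorm⟩ (⟨u, φ, hφ, hu⟩ : classicalH10 Q)
    change (γ₀.extendOfNorm e (j u) : ℝ × ℝ → ℝ) =ᵐ[arcLength S] φ
    rw [he]
    exact (hγ₀ _).trans (hS _ _ (hΦ _) hφ ((hΦu _).symm.trans hu))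

end HasLateralCurves

theorem mainTheorem4 (CΩ : ℝ) (hCΩ : 0 < CΩ) :
    ∃ C : ℝ, 0 < C ∧
      ∀ (CdΩ T : ℝ) (Ω : ℝ → Set ℝ), 0 < CdΩ → 0 < T →
        (∀ t ∈ Set.Icc 0 T, IsOpen (Ω t) ∧ Bornology.IsBounded (Ω t)) →
        IsOpen (spaceTime Ω T) →
        UniformBounds Ω T CΩ CdΩ →
        HasLateralCharts (spaceTime Ω T) (lateral Ω T) →
        (∃! γ, IsTraceOperator (spaceTime Ω T) (lateral Ω T) γ) ∧
        ∀ γ, IsTraceOperator (spaceTime Ω T) (lateral Ω T) γ →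
          ∀ u : H10 (spaceTime Ω T),
            ‖(u : L2 (spaceTime Ω T))‖ ≤ C * (‖dx u‖ + ‖γ u‖) := by

  -- The quantities `δ`, `K`, `N` obtained from the charts affect only the continuity bound of the
  -- trace, so this constant can be fixed before the domain is given.
  refine ⟨2 * CΩ + 1, by linarith, fun CdΩ T Ω _ _ hΩ hQ hB hC => ?_⟩
  obtain ⟨δ, F, N, K, c, h⟩ := exists_hasLateralCurves hΩ hQ hB hC
  have hvol : ∀ t, volume (timeSlice (spaceTime Ω T) t) ≤ ENNReal.ofReal CΩ := fun t => by
    by_cases ht : t ∈ Ioo 0 T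
    · rw [timeSlice_spaceTime ht]
      exact (hB t (Ioo_subset_Icc_self ht)).1
    · rw [timeSlice_spaceTime_of_notMem ht]
      simp
  obtain ⟨γ, hγ⟩ := h.exists_isTraceOperator
  exact ⟨⟨γ, hγ, fun γ' hγ' => h.trace_unique hγ' hγ⟩, fun γ' hγ' u =>
    h.poincare hCΩ hvol hγ' u⟩
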